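/- Let $\mathcal H(m_1,\dots,m_r)$ be a stratum of Abelian differentials in genus $g$ with numbered zeroes $P_1,\dots,P_r$ of orders $m_1,\dots,m_r\ge 1$, $\sum_i m_i=2g-2$ (the stratum $\mathcal H(0)$ of flat tori with one marked point is also allowed), and let $d=\dim_{\mathbb C}\mathcal H(m_1,\dots,m_r)=2g+r-1$. An orientable separatrix diagram $\mathcal D$ is a finite ribbon graph with oriented edges, such that incoming and outgoing half-edges alternate around each vertex, together with a decomposition of the set of boundary components of the associated ribbon surface into pairs, each consisting of one positively and one negatively oriented component (the orientation of a component induced by the edges agrees, respectively disagrees, with its orientation as boundary of the ribbon surface). It is $1$-cylinder if there is exactly one pair, and it corresponds to the stratum $\mathcal H(m_1,\dots,m_r)$ if its vertices have valences $2(m_1+1),\dots,2(m_r+1)$. Its symmetry group $\Gamma(\mathcal D)$ consists of the automorphisms of the ribbon graph that preserve the orientation of the edges and the pairing; vertices, edges and boundary components are not labelled. The diagram of a square-tiled surface is formed by its zeroes and its horizontal saddle connections, oriented to the right, with two boundary components paired when they bound the same maximal horizontal cylinder. The contribution of $\mathcal D$ to the Masur--Veech volume $\operatorname{Vol}\mathcal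 H_1(m_1,\dots,m_r)$ is $$c(\mathcal D)=2d\cdot\lim_{a\to+\infty}\frac{1}{a^d}\,\operatorname{card}\{S\},$$ where $S$ runs over the isomorphism classes of surfaces in $\mathcal H(m_1,\dots,m_r)$ with numbered zeroes that are tiled by unit squares with the zeroes at vertices of the tiling, have area at most $a$, and have horizontal separatrix diagram isomorphic to $\mathcal D$ (disregarding the numbering of the zeroes). **Proposition.** For every $1$-cylinder orientable separatrix diagram $\mathcal D$ corresponding to the stratum $\mathcal H(m_1,\dots,m_r)$ the limit above exists, and $$c(\mathcal D)=\frac{2}{|\Gamma(\mathcal D)|}\cdot\frac{\mu_1!\,\mu_2!\cdots}{(d-2)!}\cdot\zeta(d),$$ where $\mu_i$ is the number of zeroes of order $i$, i.e. the multiplicity of $i$ among $m_1,\dots,m_r$. -/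

import Mathlib

open Equiv

/-! ### Separatrix diagrams -/

/-- A ribbon graph with oriented edges, given by its set `H` of half-edges.
Every half-edge is also read as the edge it belongs to, traversed away from its base vertex. -/
structure OrientedRibbonGraph (H : Type*) where
  /-- the next half-edge, counterclockwise, at the same vertex -/
  next : Perm H
  /-- the other half of the same edge -/
  flip : Perm H
  flip_flip : ∀ x, flip (flip x) = x
  flip_ne : ∀ x, flip x ≠ x
  /-- the half-edge points away from its vertex for the orientation of its edge -/
  isOut : H → Prop
  isOut_flip : ∀ x, isOut (flip x) ↔ ¬ isOut x

namespace OrientedRibbonGraph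

variable {H : Type*} (G : OrientedRibbonGraph H)

/-- Vertices are the cycles of `next`. -/
def Vertex : Type _ := Quotient (Perm.SameCycle.setoid G.next)

/-- The vertex at which a half-edge is based. -/
def vertex (x : H) : G.Vertex := Quotient.mk (Perm.SameCycle.setoid G.next) x

/-- Going along the edge of `x` away from the vertex of `x`, and keeping the boundary of the ribbon
on the left hand side, the next traversed edge starts with the half-edge `face x`: it comes just
before `flip x` in the counterclockwise order at the other end of the edge. -/
def face : Perm H := G.next⁻¹ * G.flip

/-- Boundary components of the ribbon surface are the cycles of `face`; the half-edge `x` stands for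
the side of its edge lying to the left when the edge is traversed starting from `x`. -/
def Boundary : Type _ := Quotient (Perm.SameCycle.setoid G.face)

/-- The boundary component that runs along the left side of `x`. -/
def boundary (x : H) : G.Boundary := Quotient.mk (Perm.SameCycle.setoid G.face) x

end OrientedRibbonGraph

/-- A separatrix diagram: an oriented ribbon graph and a decomposition of the set of its boundary
components into pairs, given as an involution without fixed points. -/
structure SeparatrixDiagram (H : Type*) extends OrientedRibbonGraph H where
  partner : toOrientedRibbonGraph.Boundary → toOrientedRibbonGraph.Boundary
  partner_partner : ∀ b, partner (partner b) = b
  partner_ne : ∀ b, partner b ≠ b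

namespace SeparatrixDiagram

variable {H : Type*} (D : SeparatrixDiagram H)

/-- Orientable diagrams: (1) the orientations of half-edges alternate around every vertex.
Then, along each boundary component, either all traversed edges are traversed along
their orientation (the component lies to the left of its edges), or all are traversed against it;
(2) every pair has one component of each of the two kinds. -/
def IsOrientable : Prop :=
  (∀ x, D.isOut (D.next x) ↔ ¬ D.isOut x) ∧
    ∀ x y, D.partner (D.boundary x) = D.boundary y → (D.isOut y ↔ ¬ D.isOut x)

/-- There is exactly one pair of boundary components, i.e. exactly one cylinder. -/
def IsOneCylinder : Prop := Nat.card D.Boundary = 2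

/-- The diagram represents the stratum `ℋ(m₁, …, m_r)`: its vertices can be numbered so
that the `i`-th one has valence `2 (mᵢ + 1)`, that is, cone angle `2 π (mᵢ + 1)`. -/
def InStratum {r : ℕ} (m : Fin r → ℕ) : Prop :=
  ∃ e : Fin r ≃ D.Vertex, ∀ i, {x | D.vertex x = e i}.ncard = 2 * (m i + 1)

/-- The symmetry group of the diagram (vertices, edges and boundary components are not labelled):
permutations of the half-edges that preserve the ribbon structure, the edges, their orientation
and the pairing of the boundary components. -/
def symmetryGroup : Subgroup (Perm H) where
  carrier := {s | (∀ x, s (D.next x) = D.next (s x)) ∧ (∀ x, s (D.flip x) = D.flip (s x)) ∧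
    (∀ x, D.isOut (s x) ↔ D.isOut x) ∧
    ∀ x y, D.partner (D.boundary (s x)) = D.boundary (s y) ↔
      D.partner (D.boundary x) = D.boundary y}
  mul_mem' := by
    rintro s t ⟨h1, h2, h3, h4⟩ ⟨k1, k2, k3, k4⟩
    refine ⟨fun x => ?_, fun x => ?_, fun x => ?_, fun x y => ?_⟩
    · simp only [Perm.mul_apply, k1, h1]
    · simp only [Perm.mul_apply, k2, h2]
    · simp only [Perm.mul_apply, h3, k3]
    · simp only [Perm.mul_apply, h4, k4]
  one_mem' := by simp
  inv_mem' := by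
    rintro s ⟨h1, h2, h3, h4⟩
    refine ⟨fun x => ?_, fun x => ?_, fun x => ?_, fun x y => ?_⟩
    · rw [Perm.inv_eq_iff_eq, h1]; simp
    · rw [Perm.inv_eq_iff_eq, h2]; simp
    · rw [← h3]; simp
    · rw [← h4]; simp

end SeparatrixDiagram

/-! ### First return maps -/

section FirstReturn

variable {α : Type*} [Finite α] (f : Perm α) (C : Set α)

theorem exists_return (x : C) : ∃ k : ℕ, 0 < k ∧ (f ^ k) (x : α) ∈ C :=
  ⟨orderOf f, orderOf_pos f, by simp [pow_orderOf_eq_one]⟩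

open Classical in
/-- The first positive time at which the `f`-orbit of `x ∈ C` is again in `C`. -/
noncomputable def returnTime (x : C) : ℕ := Nat.find (exists_return f C x)

theorem returnTime_pos (x : C) : 0 < returnTime f C x := by
  classical exact (Nat.find_spec (exists_return f C x)).1

theorem returnTime_mem (x : C) : (f ^ returnTime f C x) (x : α) ∈ C := by
  classical exact (Nat.find_spec (exists_return f C x)).2

theorem returnTime_le (x : C) {k : ℕ} (hk : 0 < k) (h : (f ^ k) (x : α) ∈ C) :
    returnTime f C x ≤ k := by
  classical exact Nat.find_min' (exists_return f C x) ⟨hk, h⟩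

theorem returnTime_aux {x y : C} (h : (f ^ returnTime f C x) (x : α) = (f ^ returnTime f C y) y)
    (hle : returnTime f C x ≤ returnTime f C y) : x = y := by
  obtain ⟨j, hj⟩ := Nat.exists_eq_add_of_le hle
  rw [hj, pow_add, Perm.mul_apply] at h
  have h' : (x : α) = (f ^ j) y := (f ^ returnTime f C x).injective h
  rcases Nat.eq_zero_or_pos j with rfl | hpos
  · exact Subtype.ext (by simpa using h')
  · have h1 := returnTime_le f C y hpos (h' ▸ x.2)
    have h2 := returnTime_pos f C x
    omega

theorem firstReturn_bijective : Function.Bijective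
    (fun x : C => (⟨(f ^ returnTime f C x) (x : α), returnTime_mem f C x⟩ : C)) := by
  refine Finite.injective_iff_bijective.1 fun x y h => ?_
  have h' := Subtype.ext_iff.1 h
  rcases le_total (returnTime f C x) (returnTime f C y) with hle | hle
  · exact returnTime_aux f C h' hle
  · exact (returnTime_aux f C h'.symm hle).symm

/-- The first return map of `f` to `C`. -/
noncomputable def firstReturn : Perm C := Equiv.ofBijective _ (firstReturn_bijective f C)

end FirstReturn

/-! ### Square-tiled surfaces -/

/-- Turning counterclockwise by `2π` around the bottom left corner of a square, through the squares
`x`, `right⁻¹ x`, `up⁻¹ (right⁻¹ x)`, `right (up⁻¹ (right⁻¹ x))`, one arrives at the square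
`up (right (up⁻¹ (right⁻¹ x)))`. -/
def turnAround {α : Type*} (right up : Perm α) : Perm α := up * right * up⁻¹ * right⁻¹

/-- Vertices of the tiling. The cycle of `x` under `turnAround` is the set of the squares
having a given vertex as bottom left corner; the cone angle is `2π` times its size. -/
def TilingVertex {α : Type*} (right up : Perm α) : Type _ :=
  Quotient (Perm.SameCycle.setoid (turnAround right up))

/-- The bottom left corner of a square. -/
def corner {α : Type*} (right up : Perm α) (x : α) : TilingVertex right up :=
  Quotient.mk (Perm.SameCycle.setoid (turnAround right up)) x

/-- A square-tiled surface in the stratum `ℋ(m₁, …, m_r)` with numbered zeroes: `area` many unit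
squares, the right side of each square `x` being glued to the left side of `right x` and its top
side to the bottom side of `up x`, such that the surface is connected, together with
distinct vertices `P₁, …, P_r` of cone angles `2π (mᵢ + 1)`, all other vertices having cone
angle `2π`. -/
structure SquareTiledSurface {r : ℕ} (m : Fin r → ℕ) where
  area : ℕ
  area_pos : 0 < area
  right : Perm (Fin area)
  up : Perm (Fin area)
  connected : ∀ x y, ∃ s ∈ Subgroup.closure {right, up}, s x = y
  zero : Fin r → TilingVertex right up
  zero_injective : Function.Injective zero
  angle_zero : ∀ i, {x | corner right up x = zero i}.ncard = m i + 1
  angle_other : ∀ x, corner right up x ∉ Set.range zero → turnAround right up x = x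

namespace SquareTiledSurface

variable {r : ℕ} {m : Fin r → ℕ}

/-- Two square-tiled surfaces are the same point of the stratum if some
bijection of the squares respects the gluings and the numbering of the zeroes. -/
def Isomorphic (S T : SquareTiledSurface m) : Prop :=
  ∃ e : Fin S.area ≃ Fin T.area, (∀ x, e (S.right x) = T.right (e x)) ∧
    (∀ x, e (S.up x) = T.up (e x)) ∧
    ∀ i x, corner S.right S.up x = S.zero i ↔ corner T.right T.up (e x) = T.zero i

instance isomorphismSetoid (m : Fin r → ℕ) : Setoid (SquareTiledSurface m) where
  r := Isomorphic
  iseqv :=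
    { refl := fun S => ⟨Equiv.refl _, by simp⟩
      symm := by
        rintro S T ⟨e, h1, h2, h3⟩
        refine ⟨e.symm, fun x => ?_, fun x => ?_, fun i x => ?_⟩
        · rw [Equiv.symm_apply_eq, h1, Equiv.apply_symm_apply]
        · rw [Equiv.symm_apply_eq, h2, Equiv.apply_symm_apply]
        · rw [h3, Equiv.apply_symm_apply]
      trans := by
        rintro S T U ⟨e, h1, h2, h3⟩ ⟨f, k1, k2, k3⟩
        exact ⟨e.trans f, by simp [h1, k1], by simp [h2, k2], fun i x => by
          rw [h3, k3]; rfl⟩ }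

variable (S : SquareTiledSurface m)

/-- Squares whose bottom left corner is one of the zeroes. They are in bijection with the
horizontal saddle connections: the one of `x` starts at the bottom left corner of `x`, and
runs to the right along the bottom sides of `x`, `right x`, `right (right x)`, … up to the
first zero, which is the bottom left corner of the square `firstReturn x`. -/
def critical : Set (Fin S.area) := {x | corner S.right S.up x ∈ Set.range S.zero}

/-- The first square with bottom left corner at a zero, strictly to the right of a given one. -/
noncomputable def saddleEnd : Perm S.critical := firstReturn S.right S.critical

theorem turnAround_mem_critical (x : Fin S.area) :
    turnAround S.right S.up x ∈ S.critical ↔ x ∈ S.critical := by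
  have h : corner S.right S.up (turnAround S.right S.up x) = corner S.right S.up x :=
    Quotient.sound (s := Perm.SameCycle.setoid (turnAround S.right S.up))
      (Perm.sameCycle_apply_left.2 (Perm.SameCycle.refl _ _))
  simp only [critical, Set.mem_ofPred_eq, h]

/-- Turning by `2π` around a zero. -/
def turn : Perm S.critical := (turnAround S.right S.up).subtypePerm S.turnAround_mem_critical

/-- The union of the zeroes and of all horizontal saddle connections, as a ribbon graph whose edges
are oriented to the right. The saddle connection of `x` has the outgoing half-edge `(x, true)`
at its left end and the incoming half-edge `(x, false)` at its right end. Turning counterclockwise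
by `π` from the outgoing half-edge of `x` we meet the incoming half-edge of the saddle
connection that ends where the one of `x` starts; turning by `π` once more we meet the
outgoing half-edge of `turn x`. -/
noncomputable def criticalGraph : OrientedRibbonGraph (S.critical × Bool) where
  next :=
    { toFun := fun p => match p with
        | (x, true) => (S.saddleEnd.symm x, false)
        | (x, false) => (S.turn (S.saddleEnd x), true)
      invFun := fun p => match p with
        | (x, true) => (S.saddleEnd.symm (S.turn.symm x), false)
        | (x, false) => (S.saddleEnd x, true)
      left_inv := by rintro ⟨x, _ | _⟩ <;> simp
      right_inv := by rintro ⟨x, _ | _⟩ <;> simp }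
  flip :=
    { toFun := fun p => (p.1, !p.2)
      invFun := fun p => (p.1, !p.2)
      left_inv := by rintro ⟨x, _ | _⟩ <;> simp
      right_inv := by rintro ⟨x, _ | _⟩ <;> simp }
  flip_flip := by rintro ⟨x, _ | _⟩ <;> simp
  flip_ne := by rintro ⟨x, _ | _⟩ <;> simp
  isOut := fun p => p.2 = true
  isOut_flip := by rintro ⟨x, _ | _⟩ <;> simp

/-- Two squares belong to the same maximal horizontal cylinder, i.e. to the same connected
component of the complement of the critical graph. One passes freely from a square to its right
neighbour, and from a square to the one above it (here `y`) if the horizontal leaf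
along the bottom side of the latter contains no zero. -/
def SameCylinder : Fin S.area → Fin S.area → Prop :=
  Relation.EqvGen fun x y =>
    y = S.right x ∨ (y = S.up x ∧ ∀ z ∈ S.critical, ¬ S.right.SameCycle y z)

/-- A square adjacent to the left side of a half-edge of the critical graph: for an outgoing
half-edge it lies above the saddle connection, for an incoming one below. -/
def sideSquare (p : S.critical × Bool) : Fin S.area :=
  if p.2 then (p.1 : Fin S.area) else S.up.symm p.1

/-- The horizontal foliation of `S` has separatrix diagram `D`: the critical graph is isomorphic to
the ribbon graph of `D`, in such a way that two distinct boundary components are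
paired in `D` exactly if they bound the same cylinder of `S`. -/
def HasDiagram {H : Type*} (D : SeparatrixDiagram H) : Prop :=
  ∃ e : H ≃ S.critical × Bool,
    (∀ x, e (D.next x) = S.criticalGraph.next (e x)) ∧
    (∀ x, e (D.flip x) = S.criticalGraph.flip (e x)) ∧
    (∀ x, S.criticalGraph.isOut (e x) ↔ D.isOut x) ∧
    ∀ x y, D.boundary x ≠ D.boundary y →
      (D.partner (D.boundary x) = D.boundary y ↔
        S.SameCylinder (S.sideSquare (e x)) (S.sideSquare (e y)))

end SquareTiledSurface

/-! ### Contribution of a diagram -/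

/-- The number of points of the stratum `ℋ(m₁, …, m_r)` with numbered zeroes which are
square-tiled surfaces of area at most `a` with separatrix diagram `D`. -/
noncomputable def countSquareTiled {H : Type*} (D : SeparatrixDiagram H) {r : ℕ} (m : Fin r → ℕ)
    (a : ℝ) : ℕ :=
  {q : Quotient (SquareTiledSurface.isomorphismSetoid m) |
    ∃ S : SquareTiledSurface m, ⟦S⟧ = q ∧ (S.area : ℝ) ≤ a ∧ S.HasDiagram D}.ncard

/-- The contribution of the diagram `D` to the Masur--Veech volume of the stratum
`ℋ(m₁, …, m_r)` of complex dimension `d` exists and is equal to `c`, that is,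
`2d · lim a^{-d} · #{square-tiled surfaces of area at most a with diagram D} = c`. -/
def HasContribution {H : Type*} (D : SeparatrixDiagram H) {r : ℕ} (m : Fin r → ℕ) (d : ℕ)
    (c : ℝ) : Prop :=
  Filter.Tendsto (fun a : ℝ => 2 * (d : ℝ) * (1 / a ^ d * (countSquareTiled D m a : ℝ)))
    Filter.atTop (nhds c)

/-- The multiplicity of the entry `k` among `m₁, …, m_r`. -/
def orderMultiplicity {r : ℕ} (m : Fin r → ℕ) (k : ℕ) : ℕ :=
  (Finset.univ.filter fun i => m i = k).card

/-! ### Towers over a first return map -/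

/-! Let `E` be the set of edges of the diagram, `n` its cardinality, and `σ`, `ω` the cyclic orders
of the edges along the bottom and the top of the unique cylinder. A framing of a surface is a
bijection of `E` with its saddle connections compatible with `σ` and `ω`. A framed surface with
numbered zeroes is the same as the following data: positive lengths `ℓ` on `E`, a height `h ≥ 1`, a
twist `0 ≤ t < w` with `w = ∑ ℓ`, and a numbering of the vertices. Its area is `h * w`. Since the
zeroes have total angle `2π ∑ (mᵢ + 1)`, one has `n = ∑ (mᵢ + 1) = d - 1`.

The framings of a given surface form a torsor under Γ(D) (`card_framings`). Framings that differ by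
an automorphism of the surface have the same parameters, so the number of surfaces times |Γ| is not
exactly the number of parameters. However, when the lengths are pairwise distinct they determine the
framing, and coincidences of lengths are negligible. This is the content of
`countSquareTiled_bounds`.

For fixed `h` the parameters number `∑ w * C(w-1, n-1) = n * C(M+1, n+1)`, summed over `w ≤ M =
⌊N/h⌋`, apart from the numberings. Summing over `h` by dominated convergence (`tendsto_sum_div`)
gives `n / d! * ζ(d) * N^d`. The numberings contribute the order of the stabilizer of `m` in the
symmetric group, that is `∏ μᵢ!`. Finally `2d * n / d! = 2 / (d-2)!`.

Squares are modelled by towers, used twice: the bottom row of the cylinder is a tower over `E` with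
heights `ℓ`, and the whole cylinder is a tower of constant height `h` over the bottom row. Gluing
the top to the bottom is a permutation `π` of the bottom row that intertwines the rotations defined
by `σ` and `ω`. -/

/-- The tower of height `ℓ i` over each `i`. -/
abbrev Tower {ι : Type*} (ℓ : ι → ℕ) : Type _ := {p : ι × ℕ // p.2 < ℓ p.1}

section Tower

variable {ι α : Type*}

/-- On a finite set every point of a cycle is reached by nonnegative powers, so `R` need not be
symmetric. In particular `R` may be an inequality: a function that is monotone along a cycle is
constant on it. -/
theorem sameCycle_rel [Finite ι] {s : Perm ι} {R : ι → ι → Prop} (hrefl : ∀ i, R i i)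
    (htrans : ∀ i j k, R i j → R j k → R i k) (hstep : ∀ i, R i (s i)) {i j : ι}
    (h : s.SameCycle i j) : R i j := by
  obtain ⟨n, -, rfl⟩ := h.exists_pow_eq'
  clear h
  induction n with
  | zero => exact hrefl _
  | succ n ih => rw [pow_succ', Perm.mul_apply]; exact htrans _ _ _ ih (hstep _)

/-- Going up the tower, and from the top over `i` to the base over `s i`. -/
def towerShift (ℓ : ι → ℕ) (hℓ : ∀ i, 0 < ℓ i) (s : Perm ι) : Perm (Tower ℓ) where
  toFun p := if h : p.1.2 + 1 < ℓ p.1.1 then ⟨(p.1.1, p.1.2 + 1), h⟩ else ⟨(s p.1.1, 0), hℓ _⟩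
  invFun p := if p.1.2 = 0 then
      ⟨(s.symm p.1.1, ℓ (s.symm p.1.1) - 1), Nat.sub_lt (hℓ _) one_pos⟩
    else ⟨(p.1.1, p.1.2 - 1), lt_of_le_of_lt (Nat.sub_le _ _) p.2⟩
  left_inv := by
    rintro ⟨⟨i, k⟩, hk⟩
    by_cases h : k + 1 < ℓ i
    · simp [h]
    · have h' : k = ℓ i - 1 := by simp only at hk; omega
      subst h'
      simp [Nat.sub_add_cancel (hℓ i)]
  right_inv := by
    rintro ⟨⟨i, k⟩, hk⟩
    by_cases h : k = 0
    · subst h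
      have := hℓ (s.symm i)
      simp
      omega
    · have h' : k - 1 + 1 = k := by omega
      have hk' : k < ℓ i := hk
      simp [h, h', hk']

/-- The base of the tower. -/
def towerBase (ℓ : ι → ℕ) (hℓ : ∀ i, 0 < ℓ i) (i : ι) : Tower ℓ := ⟨(i, 0), hℓ i⟩

instance [Finite ι] (ℓ : ι → ℕ) : Finite (Tower ℓ) :=
  Finite.of_injective (β := Σ i, Fin (ℓ i)) (fun p => ⟨p.1.1, ⟨p.1.2, p.2⟩⟩) (by
    rintro ⟨⟨i, k⟩, hk⟩ ⟨⟨j, l⟩, hl⟩ h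
    obtain ⟨rfl, h⟩ := Sigma.mk.inj_iff.1 h
    obtain rfl := congrArg Fin.val (eq_of_heq h)
    rfl)

theorem card_tower [Fintype ι] (ℓ : ι → ℕ) : Nat.card (Tower ℓ) = ∑ i, ℓ i := by
  have e : Tower ℓ ≃ Σ i, Fin (ℓ i) :=
    { toFun := fun p => ⟨p.1.1, ⟨p.1.2, p.2⟩⟩
      invFun := fun p => ⟨(p.1, p.2.1), p.2.2⟩
      left_inv := fun _ => rfl
      right_inv := fun _ => rfl }
  rw [Nat.card_congr e, Nat.card_sigma]
  simp

variable {ℓ : ι → ℕ} (hℓ : ∀ i, 0 < ℓ i) (s : Perm ι)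

theorem towerBase_injective : Function.Injective (towerBase ℓ hℓ) := fun _ _ h =>
  congrArg (fun p : Tower ℓ => p.1.1) h

theorem towerShift_of_lt {p : Tower ℓ} (h : p.1.2 + 1 < ℓ p.1.1) :
    towerShift ℓ hℓ s p = ⟨(p.1.1, p.1.2 + 1), h⟩ := dif_pos h

theorem towerShift_of_not_lt {p : Tower ℓ} (h : ¬ p.1.2 + 1 < ℓ p.1.1) :
    towerShift ℓ hℓ s p = towerBase ℓ hℓ (s p.1.1) := dif_neg h

theorem towerShift_pow_base (i : ι) (k : ℕ) (hk : k < ℓ i) :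
    (towerShift ℓ hℓ s ^ k) (towerBase ℓ hℓ i) = ⟨(i, k), hk⟩ := by
  induction k with
  | zero => rfl
  | succ k ih =>
    rw [pow_succ', Perm.mul_apply, ih (by omega)]
    exact towerShift_of_lt hℓ s (p := ⟨(i, k), _⟩) hk

theorem towerShift_pow_height (i : ι) :
    (towerShift ℓ hℓ s ^ ℓ i) (towerBase ℓ hℓ i) = towerBase ℓ hℓ (s i) := by
  obtain ⟨k, hk⟩ := Nat.exists_eq_succ_of_ne_zero (hℓ i).ne'
  rw [hk, Nat.succ_eq_add_one, pow_succ', Perm.mul_apply, towerShift_pow_base hℓ s i k (by omega)]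
  exact towerShift_of_not_lt hℓ s (p := ⟨(i, k), _⟩) (by simp [hk])

theorem towerShift_transitive [Finite ι] (hs : ∀ i j, s.SameCycle i j) (p q : Tower ℓ) :
    (towerShift ℓ hℓ s).SameCycle p q := by
  have h1 : ∀ p : Tower ℓ, (towerShift ℓ hℓ s).SameCycle (towerBase ℓ hℓ p.1.1) p := fun p =>
    ⟨p.1.2, by rw [zpow_natCast, towerShift_pow_base hℓ s _ _ p.2]⟩
  have h2 : ∀ i j, (towerShift ℓ hℓ s).SameCycle (towerBase ℓ hℓ i) (towerBase ℓ hℓ j) :=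
    fun i j => sameCycle_rel (s := s)
      (R := fun i j => (towerShift ℓ hℓ s).SameCycle (towerBase ℓ hℓ i) (towerBase ℓ hℓ j))
      (fun i => Perm.SameCycle.refl _ _) (fun i j k h h' => h.trans h')
      (fun i => ⟨ℓ i, by rw [zpow_natCast, towerShift_pow_height]⟩) (hs i j)
  exact (h1 p).symm.trans ((h2 _ _).trans (h1 q))

/-- The first return map of `p` to the range of the injection `g` is `s`, with return times `ℓ`. -/
structure IsReturn (p : Perm α) (g : ι → α) (ℓ : ι → ℕ) (s : Perm ι) : Prop where
  inj : Function.Injective g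
  pos : ∀ i, 0 < ℓ i
  ret : ∀ i, (p ^ ℓ i) (g i) = g (s i)
  ne : ∀ i k, 0 < k → k < ℓ i → ∀ j, (p ^ k) (g i) ≠ g j

/-- The map of the tower determined by a map of its base. -/
def climb (p : Perm α) (g : ι → α) (ℓ : ι → ℕ) (x : Tower ℓ) : α := (p ^ x.1.2) (g x.1.1)

theorem isReturn_towerShift : IsReturn (towerShift ℓ hℓ s) (towerBase ℓ hℓ) ℓ s where
  inj := towerBase_injective hℓ
  pos := hℓ
  ret := towerShift_pow_height hℓ s
  ne i k hk hk' j h := by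
    rw [towerShift_pow_base hℓ s i k hk'] at h
    exact hk.ne' (congrArg (fun p : Tower ℓ => p.1.2) h)

theorem exists_isReturn [Finite α] (p : Perm α) {g : ι → α} (hg : Function.Injective g) :
    ∃ ℓ s, IsReturn p g ℓ s := by
  have hmem (i : ι) : g i ∈ Set.range g := ⟨i, rfl⟩
  let e : ι ≃ Set.range g := Equiv.ofInjective g hg
  refine ⟨fun i => returnTime p (Set.range g) (e i),
    (e.trans (firstReturn p (Set.range g))).trans e.symm, hg, fun i => returnTime_pos _ _ _,
    fun i => ?_, fun i k hk hk' j h => ?_⟩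
  · have : g (e.symm (firstReturn p (Set.range g) (e i))) =
        (e (e.symm (firstReturn p (Set.range g) (e i))) : α) := rfl
    rw [Equiv.trans_apply, Equiv.trans_apply, this, Equiv.apply_symm_apply]
    rfl
  · exact absurd (returnTime_le p (Set.range g) (e i) hk (h ▸ hmem j)) (not_le.2 hk')

namespace IsReturn

variable {p : Perm α} {g : ι → α} {s}

theorem height_unique {ℓ' : ι → ℕ} {s' : Perm ι} (h : IsReturn p g ℓ s) (h' : IsReturn p g ℓ' s') :
    ℓ = ℓ' := by
  funext i
  rcases lt_trichotomy (ℓ i) (ℓ' i) with hlt | heq | hlt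
  · exact absurd (h.ret i) (h'.ne i _ (h.pos i) hlt _)
  · exact heq
  · exact absurd (h'.ret i) (h.ne i _ (h'.pos i) hlt _)

theorem map_unique {s' : Perm ι} (h : IsReturn p g ℓ s) (h' : IsReturn p g ℓ s') : s = s' :=
  Equiv.ext fun i => h.inj ((h.ret i).symm.trans (h'.ret i))

theorem comp {β : Type*} {q : Perm β} {φ : α → β} (h : IsReturn p g ℓ s)
    (hφ : Function.Injective φ) (hpq : ∀ x, φ (p x) = q (φ x)) : IsReturn q (φ ∘ g) ℓ s := by
  have hpow : ∀ (k : ℕ) x, φ ((p ^ k) x) = (q ^ k) (φ x) := by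
    intro k
    induction k with
    | zero => simp
    | succ k ih => intro x; rw [pow_succ', pow_succ', Perm.mul_apply, Perm.mul_apply, hpq, ih]
  exact ⟨hφ.comp h.inj, h.pos, fun i => by simp only [Function.comp, ← hpow, h.ret],
    fun i k hk hk' j => by
      simp only [Function.comp, ← hpow]
      exact hφ.ne (h.ne i k hk hk' j)⟩

/-- Together with injectivity this makes the tower a model of `p` on the union of the orbits that
meet the range of `g`. -/
theorem climb_shift (h : IsReturn p g ℓ s) (x : Tower ℓ) :
    climb p g ℓ (towerShift ℓ h.pos s x) = p (climb p g ℓ x) := by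
  by_cases hx : x.1.2 + 1 < ℓ x.1.1
  · rw [towerShift_of_lt _ _ hx]
    simp only [climb, pow_succ', Perm.mul_apply]
  · rw [towerShift_of_not_lt _ _ hx]
    have : x.1.2 + 1 = ℓ x.1.1 := le_antisymm x.2 (not_lt.1 hx)
    simp only [climb, ← Perm.mul_apply, ← pow_succ', this, h.ret]
    rfl

/-- Going back by the smaller of the two times, one point lands in the base and the other is still
before its first return; this forces the remaining time to be zero. -/
theorem climb_injective_aux (h : IsReturn p g ℓ s) {x y : Tower ℓ}
    (hxy : climb p g ℓ x = climb p g ℓ y) (hle : x.1.2 ≤ y.1.2) : x = y := by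
  obtain ⟨k, hk⟩ := Nat.exists_eq_add_of_le hle
  rw [climb, climb, hk, pow_add, Perm.mul_apply] at hxy
  have h' : g x.1.1 = (p ^ k) (g y.1.1) := (p ^ x.1.2).injective hxy
  rcases Nat.eq_zero_or_pos k with rfl | hpos
  · exact Subtype.ext (Prod.ext (h.inj (by simpa using h')) (by simpa using hk.symm))
  · have := y.2
    exact absurd h'.symm (h.ne _ k hpos (by omega) _)

theorem climb_injective (h : IsReturn p g ℓ s) : Function.Injective (climb p g ℓ) := by
  intro x y hxy
  rcases le_total x.1.2 y.1.2 with hle | hle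
  · exact h.climb_injective_aux hxy hle
  · exact (h.climb_injective_aux hxy.symm hle).symm

theorem apply_mem_range_climb (h : IsReturn p g ℓ s) (x : α) :
    p x ∈ Set.range (climb p g ℓ) ↔ x ∈ Set.range (climb p g ℓ) := by
  constructor
  · rintro ⟨y, hy⟩
    refine ⟨(towerShift ℓ h.pos s).symm y, p.injective ?_⟩
    rw [← h.climb_shift, Equiv.apply_symm_apply, hy]
  · rintro ⟨y, rfl⟩
    exact ⟨_, h.climb_shift y⟩

theorem climb_eq_base (h : IsReturn p g ℓ s) {x : Tower ℓ} {i : ι} (hx : climb p g ℓ x = g i) :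
    x = towerBase ℓ h.pos i := h.climb_injective hx

end IsReturn

end Tower

/-! ### Surfaces with one horizontal cylinder -/

section OneCylinder

variable {E α : Type*}

/-- A square-tiled surface with one horizontal cylinder of height `h`: the
squares `f y` have the left ends of the horizontal saddle connections, of lengths `ℓ y`, as bottom
left corners; `σ` and `ω` give the saddle connection following `y` at the bottom and at the top
of the cylinder, and `π` is the identification of the top with the bottom. -/
structure IsOneCylinderTiling (σ ω : Perm E) (right up : Perm α) (f : E → α) (ℓ : E → ℕ) (h : ℕ)
    (π : Perm (Tower ℓ)) : Prop where
  isReturn : IsReturn right f ℓ σ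
  isReturn_up : IsReturn up (climb right f ℓ) (fun _ => h) π
  twist : ∀ b, π (towerShift ℓ isReturn.pos σ b) = towerShift ℓ isReturn.pos ω (π b)
  right_climb : ∀ b j, j < h → right ((up ^ j) (climb right f ℓ b)) =
    (up ^ j) (climb right f ℓ (towerShift ℓ isReturn.pos σ b))
  surjective : Function.Surjective (climb up (climb right f ℓ) (fun _ => h))

/-- The rotations of the row defined by `σ` and `ω` differ only at the last square over each saddle
connection. -/
theorem towerShift_eq_of_ne_base {ℓ : E → ℕ} (hℓ : ∀ i, 0 < ℓ i) {σ ω : Perm E} {b : Tower ℓ}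
    (hb : ∀ y, towerShift ℓ hℓ σ b ≠ towerBase ℓ hℓ y) :
    towerShift ℓ hℓ ω b = towerShift ℓ hℓ σ b := by
  by_cases h : b.1.2 + 1 < ℓ b.1.1
  · rw [towerShift_of_lt _ _ h, towerShift_of_lt _ _ h]
  · exact absurd (towerShift_of_not_lt hℓ σ h) (hb _)

theorem towerShift_eq_base {ℓ : E → ℕ} (hℓ : ∀ i, 0 < ℓ i) {σ ω : Perm E} {b : Tower ℓ} {y : E}
    (hb : towerShift ℓ hℓ σ b = towerBase ℓ hℓ (σ y)) :
    towerShift ℓ hℓ ω b = towerBase ℓ hℓ (ω y) := by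
  by_cases h : b.1.2 + 1 < ℓ b.1.1
  · rw [towerShift_of_lt _ _ h] at hb
    exact absurd (congrArg (fun p : Tower ℓ => p.1.2) hb) (Nat.succ_ne_zero _)
  · rw [towerShift_of_not_lt _ _ h] at hb ⊢
    rw [σ.injective (towerBase_injective hℓ hb)]

theorem closure_apply_mem_iff {R : Set α} {right up : Perm α} (hr : ∀ x, right x ∈ R ↔ x ∈ R)
    (hu : ∀ x, up x ∈ R ↔ x ∈ R) {s : Perm α} (hs : s ∈ Subgroup.closure {right, up}) (x : α) :
    s x ∈ R ↔ x ∈ R := by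
  induction hs using Subgroup.closure_induction generalizing x with
  | mem s hs =>
    rcases hs with rfl | rfl
    · exact hr x
    · exact hu x
  | one => rfl
  | mul s t _ _ ihs iht => rw [Perm.mul_apply, ihs, iht]
  | inv s _ ih =>
    rw [← ih (s⁻¹ x)]
    simp

/-- The decomposition of a connected square-tiled surface all of whose singularities lie on a
single horizontal leaf. -/
theorem exists_isOneCylinderTiling [Finite E] [Nonempty E] [Finite α] {σ ω : Perm E}
    (hσ : ∀ x y, σ.SameCycle x y) {right up : Perm α} {f : E → α} {ℓ : E → ℕ}
    (hf : IsReturn right f ℓ σ) (hturn : ∀ y, turnAround right up (f (σ y)) = f (ω y))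
    (hreg : ∀ x, x ∉ Set.range f → turnAround right up x = x)
    (hconn : ∀ x y, ∃ s ∈ Subgroup.closure {right, up}, s x = y) :
    ∃ h π, 0 < h ∧ IsOneCylinderTiling σ ω right up f ℓ h π := by
  set β := climb right f ℓ with hβ
  obtain ⟨ℓ', π, hup⟩ := exists_isReturn up hf.climb_injective
  rw [← hβ] at hup
  have hT : ∀ z, turnAround right up (right z) = up (right (up.symm z)) := fun z => by
    simp [turnAround, Perm.mul_apply]
  -- Away from the zeroes a turn by 2π is trivial, that is, `right` and `up` commute; so the rows
  -- climb in parallel until they return to the bottom row.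
  have hright : ∀ b j, j < ℓ' b →
      right ((up ^ j) (β b)) = (up ^ j) (β (towerShift ℓ hf.pos σ b)) := by
    intro b j
    induction j with
    | zero => intro _; exact (hf.climb_shift b).symm
    | succ j ih =>
      intro hj
      have hz : (up ^ (j + 1)) (β b) ∉ Set.range β := by
        rintro ⟨c, hc⟩
        exact hup.ne b (j + 1) j.succ_pos hj c hc.symm
      have hz' : right ((up ^ (j + 1)) (β b)) ∉ Set.range f := by
        rintro ⟨y, hy⟩
        exact hz ((hf.apply_mem_range_climb _).1 ⟨towerBase ℓ hf.pos y, hy⟩)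
      rw [← hreg _ hz', hT, pow_succ', Perm.mul_apply, Equiv.symm_apply_apply, ih (by omega)]
      rfl
  -- If the right neighbour returned earlier, `hright` at that time and the invariance of the bottom
  -- row under `right` would make `b` return then too.
  have hle : ∀ b, ℓ' b ≤ ℓ' (towerShift ℓ hf.pos σ b) := by
    intro b
    by_contra! hlt
    have h1 := hright b _ hlt
    rw [hup.ret] at h1
    obtain ⟨c, hc⟩ := (hf.apply_mem_range_climb ((up ^ ℓ' (towerShift ℓ hf.pos σ b)) (β b))).1
      ⟨_, h1.symm⟩
    exact hup.ne b _ (hup.pos _) hlt c hc.symm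
  -- The bottom row is a single cycle, so the monotone return time is constant: this is the height
  -- of the cylinder.
  have hconst : ∀ b c, ℓ' b ≤ ℓ' c := fun b c =>
    sameCycle_rel (R := fun b c => ℓ' b ≤ ℓ' c) (fun _ => le_rfl) (fun _ _ _ => le_trans) hle
      (towerShift_transitive hf.pos σ hσ b c)
  obtain ⟨y₀⟩ := ‹Nonempty E›
  obtain ⟨h, rfl⟩ : ∃ h, ℓ' = fun _ => h :=
    ⟨ℓ' (towerBase ℓ hf.pos y₀), funext fun b => le_antisymm (hconst _ _) (hconst _ _)⟩
  refine ⟨h, π, hup.pos (towerBase ℓ hf.pos y₀), hf, hup, fun b => hf.climb_injective ?_,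
    hright, ?_⟩
  -- To compare neighbours on the top side, step down across it, go right and step up again: this is
  -- a turn by 2π around the common corner. It replaces `σ` by `ω` exactly when that corner is a
  -- zero.
  · have h1 : turnAround right up (right (β (π b))) = β (π (towerShift ℓ hf.pos σ b)) := by
      rw [hT, ← hup.ret, ← hup.ret]
      obtain ⟨k, hk⟩ := Nat.exists_eq_succ_of_ne_zero (hup.pos b).ne'
      simp only [hk, Nat.succ_eq_add_one]
      rw [pow_succ', Perm.mul_apply, Equiv.symm_apply_apply, hright b k (by simp only [hk]; omega)]
      rfl
    rw [← hβ, ← h1, hβ, ← hf.climb_shift, ← hβ]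
    by_cases hb : ∃ y, towerShift ℓ hf.pos σ (π b) = towerBase ℓ hf.pos y
    · obtain ⟨y, hy⟩ := hb
      obtain ⟨y, rfl⟩ := σ.surjective y
      rw [towerShift_eq_base (ω := ω) hf.pos hy, hy]
      exact hturn y
    · push Not at hb
      rw [towerShift_eq_of_ne_base (ω := ω) hf.pos hb, hreg]
      rintro ⟨y, hy⟩
      exact hb y (hf.climb_eq_base hy.symm)
  -- The squares of the cylinder are stable under `right` and `up`, so connectedness leaves no
  -- others.
  · set R := Set.range (climb up β fun _ => h)
    have hR : ∀ x, right x ∈ R ↔ x ∈ R := by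
      have : Set.MapsTo right R R := by
        rintro _ ⟨⟨⟨b, j⟩, hj⟩, rfl⟩
        exact ⟨⟨(towerShift ℓ hf.pos σ b, j), hj⟩, (hright b j hj).symm⟩
      intro x
      refine ⟨fun hx => ?_, fun hx => this hx⟩
      simpa using (Perm.perm_symm_mapsTo_of_mapsTo right this) hx
    intro x
    obtain ⟨s, hs, rfl⟩ := hconn (f y₀) x
    exact (closure_apply_mem_iff hR hup.apply_mem_range_climb hs _).2
      ⟨towerBase _ hup.pos (towerBase ℓ hf.pos y₀), rfl⟩

namespace IsOneCylinderTiling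

variable {σ ω : Perm E} {right up : Perm α} {f : E → α} {ℓ : E → ℕ} {h : ℕ} {π : Perm (Tower ℓ)}

theorem card_eq [Fintype E] (H : IsOneCylinderTiling σ ω right up f ℓ h π) :
    Nat.card α = h * ∑ y, ℓ y := by
  have := Fintype.ofFinite (Tower ℓ)
  rw [← Nat.card_congr (Equiv.ofBijective _ ⟨H.isReturn_up.climb_injective, H.surjective⟩),
    card_tower, Finset.sum_const, smul_eq_mul, mul_comm, Finset.card_univ,
    ← Nat.card_eq_fintype_card, card_tower]

theorem right_climb' (H : IsOneCylinderTiling σ ω right up f ℓ h π) (x : Tower fun _ : Tower ℓ => h) :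
    right (climb up (climb right f ℓ) (fun _ => h) x) = climb up (climb right f ℓ) (fun _ => h)
      (⟨(towerShift ℓ H.isReturn.pos σ x.1.1, x.1.2), x.2⟩ : Tower fun _ : Tower ℓ => h) :=
  H.right_climb _ _ x.2

/-- Tilings with the same combinatorics, lengths, height and gluing map are isomorphic. -/
theorem exists_equiv {α' : Type*} {right' up' : Perm α'} {f' : E → α'}
    (H : IsOneCylinderTiling σ ω right up f ℓ h π)
    (H' : IsOneCylinderTiling σ ω right' up' f' ℓ h π) :
    ∃ e : α ≃ α', (∀ x, e (right x) = right' (e x)) ∧ (∀ x, e (up x) = up' (e x)) ∧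
      ∀ y, e (f y) = f' y := by
  let φ := Equiv.ofBijective _ ⟨H.isReturn_up.climb_injective, H.surjective⟩
  let φ' := Equiv.ofBijective _ ⟨H'.isReturn_up.climb_injective, H'.surjective⟩
  have key : ∀ x, (φ.symm.trans φ') (φ x) = φ' x := fun x => by simp
  refine ⟨φ.symm.trans φ', fun x => ?_, fun x => ?_, fun y => ?_⟩
  · obtain ⟨x, rfl⟩ := φ.surjective x
    have h1 := H.right_climb' x
    have h2 := H'.right_climb' x
    exact (congrArg _ h1).trans ((key _).trans (h2.symm.trans (congrArg right' (key x).symm)))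
  · obtain ⟨x, rfl⟩ := φ.surjective x
    have h1 := H.isReturn_up.climb_shift x
    have h2 := H'.isReturn_up.climb_shift x
    exact (congrArg _ h1.symm).trans ((key _).trans (h2.trans (congrArg up' (key x).symm)))
  · exact key (towerBase _ H.isReturn_up.pos (towerBase ℓ H.isReturn.pos y))

/-- An intertwiner out of a transitive rotation is determined by one value; hence one integer, the
twist, encodes `π`. -/
theorem gluing_unique [Finite E] {α' : Type*} {right' up' : Perm α'} {f' : E → α'}
    {π' : Perm (Tower ℓ)} (hσ : ∀ x y, σ.SameCycle x y)
    (H : IsOneCylinderTiling σ ω right up f ℓ h π)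
    (H' : IsOneCylinderTiling σ ω right' up' f' ℓ h π') {b : Tower ℓ} (hb : π b = π' b) :
    π = π' := by
  refine Equiv.ext fun c => ?_
  have := sameCycle_rel (R := fun b c => π b = π' b → π c = π' c) (fun _ => id)
    (fun _ _ _ h1 h2 h => h2 (h1 h)) (fun b hb => by rw [H.twist, hb, H'.twist])
    (towerShift_transitive H.isReturn.pos σ hσ b c)
  exact this hb

end IsOneCylinderTiling

end OneCylinder

/-! ### Building one-cylinder surfaces from gluing data -/

section OneCylinderModel

variable {E α : Type*}

namespace IsOneCylinderTiling

variable {σ ω : Perm E} {right up : Perm α} {f : E → α} {ℓ : E → ℕ} {h : ℕ} {π : Perm (Tower ℓ)}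

theorem turnAround_right (right up : Perm α) (z : α) :
    turnAround right up (right z) = up (right (up.symm z)) := by
  simp [turnAround, Perm.mul_apply]

theorem height_pos [Nonempty E] (H : IsOneCylinderTiling σ ω right up f ℓ h π) : 0 < h :=
  H.isReturn_up.pos (towerBase ℓ H.isReturn.pos (Classical.arbitrary E))

/-- The turn goes down into the top row of the cylinder, right, and up again; through `π` the
intertwining relation `twist` converts the `σ`-step into an `ω`-step. -/
theorem turnAround_climb (H : IsOneCylinderTiling σ ω right up f ℓ h π) (b : Tower ℓ) :
    turnAround right up (climb right f ℓ (towerShift ℓ H.isReturn.pos σ b)) =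
      climb right f ℓ (towerShift ℓ H.isReturn.pos ω b) := by
  obtain ⟨c, rfl⟩ := π.surjective b
  obtain ⟨k, rfl⟩ := Nat.exists_eq_succ_of_ne_zero (H.isReturn_up.pos c).ne'
  rw [H.isReturn.climb_shift, turnAround_right, ← H.isReturn_up.ret]
  change up (right (up.symm ((up ^ (k + 1)) _))) = _
  rw [pow_succ',
    Perm.mul_apply, Equiv.symm_apply_apply, H.right_climb _ _ k.lt_succ_self, ← Perm.mul_apply,
    ← pow_succ', ← H.twist]
  exact H.isReturn_up.ret _

theorem turnAround_base (H : IsOneCylinderTiling σ ω right up f ℓ h π) (y : E) :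
    turnAround right up (f (σ y)) = f (ω y) := by
  obtain ⟨b, hb⟩ := (towerShift ℓ H.isReturn.pos σ).surjective (towerBase ℓ H.isReturn.pos (σ y))
  have := H.turnAround_climb b
  rw [towerShift_eq_base (ω := ω) _ hb, hb] at this
  exact this

/-- In the bottom row the two rotations agree off the ends of saddle connections; in the higher rows
`right` and `up` commute by `right_climb`. -/
theorem turnAround_of_notMem (H : IsOneCylinderTiling σ ω right up f ℓ h π) {x : α}
    (hx : x ∉ Set.range f) : turnAround right up x = x := by
  obtain ⟨⟨⟨b, j⟩, hj⟩, rfl⟩ := H.surjective x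
  obtain ⟨b, rfl⟩ := (towerShift ℓ H.isReturn.pos σ).surjective b
  cases j with
  | zero =>
    refine (H.turnAround_climb b).trans (congrArg _ (towerShift_eq_of_ne_base _ fun y hy => ?_))
    exact hx ⟨y, (congrArg (climb right f ℓ) hy).symm⟩
  | succ k =>
    have hj : k + 1 < h := hj
    simp only [climb] at hx ⊢
    change turnAround right up ((up ^ (k + 1)) (climb right f ℓ _)) =
      (up ^ (k + 1)) (climb right f ℓ _)
    rw [← H.right_climb b _ hj, turnAround_right, pow_succ', Perm.mul_apply,
      Equiv.symm_apply_apply, H.right_climb b k (by omega)]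
    have := H.right_climb b _ hj
    rw [pow_succ'] at this
    exact this.symm

theorem exists_closure_apply_eq [Finite E] (H : IsOneCylinderTiling σ ω right up f ℓ h π)
    (hσ : ∀ x y, σ.SameCycle x y) (x y : α) : ∃ s ∈ Subgroup.closure {right, up}, s x = y := by
  have hr : right ∈ Subgroup.closure {right, up} := Subgroup.subset_closure (by simp)
  have hu : up ∈ Subgroup.closure {right, up} := Subgroup.subset_closure (by simp)
  have h1 : ∀ b c, ∃ s ∈ Subgroup.closure {right, up}, s (climb right f ℓ b) = climb right f ℓ c :=
    fun b c => sameCycle_rel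
      (R := fun b c => ∃ s ∈ Subgroup.closure {right, up}, s (climb right f ℓ b) = climb right f ℓ c)
      (fun _ => ⟨1, one_mem _, rfl⟩)
      (by
        rintro i j k ⟨s, hs, h1⟩ ⟨t, ht, h2⟩
        exact ⟨t * s, mul_mem ht hs, by rw [Perm.mul_apply, h1, h2]⟩)
      (fun b => ⟨right, hr, (H.isReturn.climb_shift b).symm⟩)
      (towerShift_transitive H.isReturn.pos σ hσ b c)
  obtain ⟨⟨⟨b, j⟩, hj⟩, rfl⟩ := H.surjective x
  obtain ⟨⟨⟨c, k⟩, hk⟩, rfl⟩ := H.surjective y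
  obtain ⟨s, hs, hbc⟩ := h1 b c
  refine ⟨up ^ k * (s * (up ^ j)⁻¹), mul_mem (pow_mem hu k) (mul_mem hs
    (inv_mem (pow_mem hu j))), ?_⟩
  simp only [Perm.mul_apply]
  have : (up ^ j)⁻¹ (climb up (climb right f ℓ) (fun _ => h) ⟨(b, j), hj⟩) = climb right f ℓ b :=
    (up ^ j).symm_apply_apply _
  rw [this, hbc]
  rfl

theorem climb_comp {β : Type*} {p : Perm α} {q : Perm β} {e : α → β} (he : ∀ x, e (p x) = q (e x))
    {ι : Type*} (g : ι → α) (ℓ : ι → ℕ) : climb q (e ∘ g) ℓ = e ∘ climb p g ℓ := by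
  have hpow : ∀ (k : ℕ) x, e ((p ^ k) x) = (q ^ k) (e x) := by
    intro k
    induction k with
    | zero => simp
    | succ k ih => intro x; rw [pow_succ', pow_succ', Perm.mul_apply, Perm.mul_apply, he, ih]
  funext x
  exact (hpow _ _).symm

theorem comp {β : Type*} {right' up' : Perm β} (H : IsOneCylinderTiling σ ω right up f ℓ h π)
    (e : α ≃ β) (hr : ∀ x, e (right x) = right' (e x)) (hu : ∀ x, e (up x) = up' (e x)) :
    IsOneCylinderTiling σ ω right' up' (e ∘ f) ℓ h π := by
  have hc := climb_comp hr f ℓ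
  have hc' := climb_comp hu (climb right f ℓ) (fun _ => h)
  have hpow := fun b j (hj : j < h) => congrFun hc' ⟨(b, j), hj⟩
  refine ⟨H.isReturn.comp e.injective hr, hc ▸ H.isReturn_up.comp e.injective hu, H.twist, ?_, ?_⟩
  · intro b j hj
    rw [hc]
    refine (congrArg right' (hpow b j hj)).trans (Eq.trans ?_ (hpow _ j hj).symm)
    exact (hr _).symm.trans (congrArg e (H.right_climb b j hj))
  · rw [hc, hc']
    exact e.surjective.comp H.surjective

end IsOneCylinderTiling

/-- The surface obtained from a cylinder of height `h`, whose bottom is subdivided according to `σ`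
and `ℓ`, by gluing its top to its bottom by `π`. -/
theorem exists_isOneCylinderTiling_of_gluing {σ ω : Perm E} {ℓ : E → ℕ} (hℓ : ∀ y, 0 < ℓ y) {h : ℕ}
    (hh : 0 < h) {π : Perm (Tower ℓ)}
    (hπ : ∀ b, π (towerShift ℓ hℓ σ b) = towerShift ℓ hℓ ω (π b)) :
    ∃ (right up : Perm (Tower fun _ : Tower ℓ => h)) (f : E → Tower fun _ : Tower ℓ => h),
      IsOneCylinderTiling σ ω right up f ℓ h π := by
  have hh' : ∀ _ : Tower ℓ, 0 < h := fun _ => hh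
  let right : Perm (Tower fun _ : Tower ℓ => h) :=
    { toFun := fun x => ⟨(towerShift ℓ hℓ σ x.1.1, x.1.2), x.2⟩
      invFun := fun x => ⟨((towerShift ℓ hℓ σ).symm x.1.1, x.1.2), x.2⟩
      left_inv := fun x => by simp
      right_inv := fun x => by simp }
  let up := towerShift (fun _ : Tower ℓ => h) hh' π
  have hr : IsReturn right (towerBase _ hh' ∘ towerBase ℓ hℓ) ℓ σ :=
    (isReturn_towerShift hℓ σ).comp (towerBase_injective hh') fun b => rfl
  have hβ : climb right (towerBase _ hh' ∘ towerBase ℓ hℓ) ℓ = towerBase _ hh' := by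
    rw [IsOneCylinderTiling.climb_comp (p := towerShift ℓ hℓ σ) (e := towerBase _ hh') (fun b => rfl)]
    funext b
    exact congrArg _ (towerShift_pow_base hℓ σ _ _ b.2)
  have hup : IsReturn up (towerBase _ hh') (fun _ => h) π := isReturn_towerShift hh' π
  have hpow : ∀ b j (hj : j < h), (up ^ j) (towerBase _ hh' b) = ⟨(b, j), hj⟩ := fun b j hj =>
    towerShift_pow_base hh' π b j hj
  refine ⟨right, up, towerBase _ hh' ∘ towerBase ℓ hℓ, hr, hβ ▸ hup, hπ, ?_, ?_⟩
  · intro b j hj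
    rw [hβ, hpow b j hj, hpow _ j hj]
    rfl
  · rw [hβ]
    exact fun x => ⟨x, hpow _ _ x.2⟩

/-- Two transitive permutations of a finite set are full cycles, hence conjugate; composing with a
power of `t`, which commutes with `t`, adjusts the value at `b`. -/
theorem exists_perm_intertwining {B : Type*} [Finite B] {s t : Perm B} (hs : ∀ x y, s.SameCycle x y)
    (ht : ∀ x y, t.SameCycle x y) (b c : B) : ∃ π : Perm B, (∀ x, π (s x) = t (π x)) ∧ π b = c := by
  classical
  have := Fintype.ofFinite B
  have main : ∃ π : Perm B, ∀ x, π (s x) = t (π x) := by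
    -- On a set with one element the identity is transitive but not `IsCycle`.
    rcases subsingleton_or_nontrivial B with _ | _
    · exact ⟨1, fun x => Subsingleton.elim _ _⟩
    · have key : ∀ {u : Perm B}, (∀ x y, u.SameCycle x y) → u.IsCycle ∧ u.support = Finset.univ := by
        intro u hu
        have hne : ∀ x, u x ≠ x := fun x hx => by
          obtain ⟨y, hy⟩ := exists_ne x
          obtain ⟨n, hn⟩ := hu x y
          exact hy (hn.symm.trans (Perm.zpow_apply_eq_self_of_apply_eq_self hx n))
        exact ⟨⟨b, hne b, fun y _ => hu b y⟩, by ext x; simp [hne x]⟩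
      obtain ⟨π, hπ⟩ := isConj_iff.1
        ((key hs).1.isConj (key ht).1 (by rw [(key hs).2, (key ht).2]))
      exact ⟨π, fun x => by rw [← hπ]; simp⟩
  obtain ⟨π, hπ⟩ := main
  obtain ⟨n, hn⟩ := ht (π b) c
  refine ⟨t ^ n * π, fun x => ?_, hn⟩
  have hcomm : t ^ n * t = t * t ^ n := ((Commute.refl t).zpow_left n).eq
  rw [Perm.mul_apply, hπ]
  exact congrArg (fun u : Perm B => u (π x)) hcomm

theorem exists_pow_apply_eq_of_transitive {B : Type*} [Finite B] {s : Perm B}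
    (hs : ∀ x y, s.SameCycle x y) (b c : B) : ∃ n < Nat.card B, (s ^ n) b = c := by
  have := Fintype.ofFinite B
  have h : s.IsCycleOn (Finset.univ : Finset B) := ⟨by simp, fun x _ y _ => hs x y⟩
  rw [Nat.card_eq_fintype_card]
  exact h.exists_pow_eq (Finset.mem_univ b) (Finset.mem_univ c)

theorem pow_apply_injOn_of_transitive {B : Type*} [Finite B] {s : Perm B}
    (hs : ∀ x y, s.SameCycle x y) {b : B} {k n : ℕ} (hk : k < Nat.card B) (hn : n < Nat.card B)
    (h : (s ^ k) b = (s ^ n) b) : k = n := by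
  have := Fintype.ofFinite B
  have h' : s.IsCycleOn (Finset.univ : Finset B) := ⟨by simp, fun x _ y _ => hs x y⟩
  rw [Nat.card_eq_fintype_card] at hk hn
  exact Nat.ModEq.eq_of_lt_of_lt ((h'.pow_apply_eq_pow_apply (Finset.mem_univ b)).1 h) hk hn

end OneCylinderModel

/-- Numberings of the cycles of `κ` by `Fin r` such that the `i`-th one has `m i + 1` elements. -/
def IsLabelling {E : Type*} (κ : Perm E) {r : ℕ} (m : Fin r → ℕ) (lab : E → Fin r) : Prop :=
  (∀ x y, lab x = lab y ↔ κ.SameCycle x y) ∧ ∀ i, {x | lab x = i}.ncard = m i + 1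

/-! ### The two cyclic orders of a one-cylinder diagram -/

namespace SeparatrixDiagram

variable {H : Type*} {D : SeparatrixDiagram H}

theorem IsOrientable.isOut_face (hor : D.IsOrientable) (x : H) : D.isOut (D.face x) ↔ D.isOut x := by
  have h := hor.1 (D.face x)
  have h2 : D.next (D.face x) = D.flip x := by simp [OrientedRibbonGraph.face]
  rw [h2, D.isOut_flip] at h
  exact (not_iff_not.1 h).symm

theorem IsOrientable.isOut_next_flip (hor : D.IsOrientable) (x : H) :
    D.isOut (D.next (D.flip x)) ↔ D.isOut x := by
  rw [hor.1, D.isOut_flip, not_not]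

/-- The edges of the diagram, represented by their outgoing half-edges. -/
abbrev Edge (D : SeparatrixDiagram H) : Type _ := {x : H // D.isOut x}

/-- The cyclic order of the edges along the boundary components that have the edges on
their left. -/
def bottomPerm (hor : D.IsOrientable) : Perm D.Edge := D.face.subtypePerm hor.isOut_face

/-- The cyclic order of the edges along the boundary components that have the edges on
their right. -/
def topPerm (hor : D.IsOrientable) : Perm D.Edge :=
  (D.next * D.flip).subtypePerm hor.isOut_next_flip

@[simp] theorem coe_bottomPerm (hor : D.IsOrientable) (x : D.Edge) :
    (bottomPerm hor x : H) = D.face x := rfl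

@[simp] theorem coe_topPerm (hor : D.IsOrientable) (x : D.Edge) :
    (topPerm hor x : H) = D.next (D.flip x) := rfl

theorem next_bottomPerm (hor : D.IsOrientable) (x : D.Edge) :
    D.next (bottomPerm hor x) = D.flip x := by
  simp [OrientedRibbonGraph.face]

/-- Hence `topPerm * bottomPerm⁻¹` is the turn by 2π, two half-edges further, and its cycles are the
vertices. -/
theorem next_next_bottomPerm (hor : D.IsOrientable) (x : D.Edge) :
    D.next (D.next (bottomPerm hor x)) = topPerm hor x := by
  rw [next_bottomPerm, coe_topPerm]

theorem boundary_eq_boundary_iff {x y : H} :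
    D.boundary x = D.boundary y ↔ D.face.SameCycle x y := Quotient.eq (r := Perm.SameCycle.setoid D.face)

theorem vertex_eq_vertex_iff {x y : H} :
    D.vertex x = D.vertex y ↔ D.next.SameCycle x y := Quotient.eq (r := Perm.SameCycle.setoid D.next)

theorem IsOrientable.isOut_iff_of_boundary_eq [Finite H] (hor : D.IsOrientable) {x y : H}
    (h : D.boundary x = D.boundary y) : D.isOut x ↔ D.isOut y :=
  sameCycle_rel (R := fun x y => D.isOut x ↔ D.isOut y) (fun _ => Iff.rfl)
    (fun _ _ _ => Iff.trans) (fun x => (hor.isOut_face x).symm) (boundary_eq_boundary_iff.1 h)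

/-- The two sides of an edge have opposite orientations, so the only two boundary components are
told apart by orientation. The pairing then carries no information of its own. -/
theorem boundary_eq_iff_isOut [Finite H] (hor : D.IsOrientable) (hone : D.IsOneCylinder) {x y : H} :
    D.boundary x = D.boundary y ↔ (D.isOut x ↔ D.isOut y) := by
  refine ⟨hor.isOut_iff_of_boundary_eq, fun h => ?_⟩
  obtain ⟨a, b, -, hab⟩ := (Nat.card_eq_two_iff (α := D.Boundary)).1 hone
  have hcov : ∀ z, z = a ∨ z = b := fun z => by
    have : z ∈ ({a, b} : Set D.Boundary) := hab ▸ Set.mem_univ z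
    simpa using this
  have hx : D.boundary x ≠ D.boundary (D.flip x) := fun h' => by
    have := hor.isOut_iff_of_boundary_eq h'
    rw [D.isOut_flip] at this
    tauto
  have hy : D.boundary y ≠ D.boundary (D.flip x) := fun h' => by
    have := hor.isOut_iff_of_boundary_eq h'
    rw [D.isOut_flip] at this
    tauto
  rcases hcov (D.boundary x) with h1 | h1 <;> rcases hcov (D.boundary y) with h2 | h2 <;>
    rcases hcov (D.boundary (D.flip x)) with h3 | h3 <;> simp_all

theorem partner_boundary_iff [Finite H] (hor : D.IsOrientable) (hone : D.IsOneCylinder) (x y : H) :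
    D.partner (D.boundary x) = D.boundary y ↔ ¬ (D.isOut x ↔ D.isOut y) := by
  refine ⟨fun h => ?_, fun h => ?_⟩
  · have := hor.2 x y h
    tauto
  · obtain ⟨z, hz⟩ : ∃ z, D.boundary z = D.partner (D.boundary x) := Quotient.exists_rep _
    have h1 := hor.2 x z hz.symm
    rw [← hz, boundary_eq_iff_isOut hor hone]
    tauto

theorem bottomPerm_sameCycle [Finite H] (hor : D.IsOrientable) (hone : D.IsOneCylinder)
    (x y : D.Edge) : (bottomPerm hor).SameCycle x y := by
  have h : D.boundary x = D.boundary y :=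
    (boundary_eq_iff_isOut hor hone).2 (iff_of_true x.2 y.2)
  exact Perm.sameCycle_subtypePerm.2 (boundary_eq_boundary_iff.1 h)

/-- Conjugation by `flip` turns `next * flip` into the inverse of `face`, so the top order is the
negative boundary component read backwards. -/
theorem topPerm_sameCycle [Finite H] (hor : D.IsOrientable) (hone : D.IsOneCylinder)
    (x y : D.Edge) : (topPerm hor).SameCycle x y := by
  have h : D.boundary (D.flip y) = D.boundary (D.flip x) := by
    rw [boundary_eq_iff_isOut hor hone, D.isOut_flip, D.isOut_flip]
    exact iff_of_false (not_not.2 y.2) (not_not.2 x.2)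
  refine Perm.sameCycle_subtypePerm.2 ?_
  have key := sameCycle_rel
    (R := fun a b => (D.next * D.flip).SameCycle (D.flip b) (D.flip a)) (fun _ => Perm.SameCycle.refl _ _)
    (fun _ _ _ h h' => h'.trans h) (fun a => ⟨1, by simp [OrientedRibbonGraph.face, D.flip_flip]⟩)
    (boundary_eq_boundary_iff.1 h)
  simpa only [D.flip_flip] using key

theorem nonempty_edge (hone : D.IsOneCylinder) : Nonempty D.Edge := by
  have : Nonempty D.Boundary := by
    by_contra h
    rw [not_nonempty_iff] at h
    rw [IsOneCylinder, Nat.card_of_isEmpty] at hone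
    omega
  obtain ⟨x, -⟩ := Quotient.exists_rep this.some
  by_cases hx : D.isOut x
  · exact ⟨⟨x, hx⟩⟩
  · exact ⟨⟨D.flip x, (D.isOut_flip x).2 hx⟩⟩

theorem isOut_next_pow (hor : D.IsOrientable) (x : H) (n : ℕ) :
    D.isOut ((D.next ^ n) x) ↔ (D.isOut x ↔ Even n) := by
  induction n with
  | zero => simp
  | succ n ih =>
    rw [pow_succ', Perm.mul_apply, hor.1, ih, Nat.even_add_one]
    tauto

theorem vertex_eq_iff_sameCycle [Finite H] (hor : D.IsOrientable) (x y : D.Edge) :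
    D.vertex x = D.vertex y ↔ (topPerm hor * (bottomPerm hor)⁻¹).SameCycle x y := by
  have hstep : ∀ z, ((topPerm hor * (bottomPerm hor)⁻¹) z : H) = D.next (D.next z) := fun z => by
    obtain ⟨z, rfl⟩ := (bottomPerm hor).surjective z
    rw [next_next_bottomPerm]
    simp [Perm.mul_apply]
  have hpow : ∀ (n : ℕ) (z : D.Edge), (((topPerm hor * (bottomPerm hor)⁻¹) ^ n) z : H) =
      (D.next ^ (n + n)) z := by
    intro n
    induction n with
    | zero => simp
    | succ n ih =>
      intro z
      rw [pow_succ', Perm.mul_apply, hstep, ih, show n + 1 + (n + 1) = n + n + 1 + 1 by ring,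
        pow_succ', pow_succ']
      rfl
  rw [vertex_eq_vertex_iff]
  constructor
  · intro h
    obtain ⟨n, -, hn⟩ := h.exists_pow_eq'
    -- Outgoing half-edges at a vertex are an even number of steps apart.
    have := isOut_next_pow hor x n
    rw [hn] at this
    obtain ⟨k, rfl⟩ := (this.1 y.2).1 x.2
    exact ⟨k, Subtype.ext (by rw [zpow_natCast, hpow, hn])⟩
  · intro h
    obtain ⟨n, -, hn⟩ := h.exists_pow_eq'
    exact ⟨(n + n : ℕ), by rw [zpow_natCast, ← hpow, hn]⟩

theorem InStratum.exists_isLabelling [Finite H] (hor : D.IsOrientable) {r : ℕ} {m : Fin r → ℕ}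
    (hD : D.InStratum m) : ∃ lab, IsLabelling (topPerm hor * (bottomPerm hor)⁻¹) m lab := by
  obtain ⟨e, he⟩ := hD
  refine ⟨fun x => e.symm (D.vertex x), fun x y => ?_, fun i => ?_⟩
  · rw [e.symm.injective.eq_iff, vertex_eq_iff_sameCycle hor]
  · have hnext : ∀ x, D.vertex (D.next x) = D.vertex x := fun x =>
      vertex_eq_vertex_iff.2 (Perm.sameCycle_apply_left.2 (Perm.SameCycle.refl _ _))
    have h1 : {x : D.Edge | e.symm (D.vertex x) = i}.ncard =
        {x | D.vertex x = e i ∧ D.isOut x}.ncard := by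
      rw [← Set.ncard_image_of_injective _ Subtype.val_injective]
      congr 1
      ext x
      simp [Equiv.symm_apply_eq]
    -- `next` exchanges incoming and outgoing half-edges, so exactly half of the valence `2 (m i +
    -- 1)` is outgoing.
    have h2 : {x | D.vertex x = e i ∧ ¬ D.isOut x}.ncard =
        {x | D.vertex x = e i ∧ D.isOut x}.ncard := by
      rw [← Set.ncard_image_of_injective _ D.next.injective]
      congr 1
      ext x
      constructor
      · rintro ⟨y, ⟨hy, hy'⟩, rfl⟩
        exact ⟨(hnext y).trans hy, (hor.1 y).2 hy'⟩
      · rintro ⟨hx, hx'⟩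
        refine ⟨D.next.symm x, ⟨?_, ?_⟩, by simp⟩
        · rw [← hx, ← hnext (D.next.symm x), Equiv.apply_symm_apply]
        · rw [← hor.1, Equiv.apply_symm_apply]
          exact hx'
    have h3 : {x | D.vertex x = e i}.ncard =
        {x | D.vertex x = e i ∧ D.isOut x}.ncard + {x | D.vertex x = e i ∧ ¬ D.isOut x}.ncard := by
      rw [← Set.ncard_union_eq]
      · congr 1
        ext x
        simp only [Set.mem_union, Set.mem_ofPred_eq]
        tauto
      · rw [Set.disjoint_left]
        rintro x ⟨-, h⟩ ⟨-, h'⟩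
        exact h' h
    have := he i
    refine h1.trans ?_
    omega

end SeparatrixDiagram

theorem sameCycle_iff_of_semiconj {E α : Type*} [Finite E] [Finite α] {κ : Perm E} {T : Perm α}
    {f : E → α} (h : ∀ y, T (f y) = f (κ y)) {x : E} {z : α} :
    T.SameCycle (f x) z ↔ ∃ y, z = f y ∧ κ.SameCycle x y := by
  have hpow : ∀ (n : ℕ) y, (T ^ n) (f y) = f ((κ ^ n) y) := by
    intro n
    induction n with
    | zero => simp
    | succ n ih => intro y; rw [pow_succ', pow_succ', Perm.mul_apply, Perm.mul_apply, ih, h]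
  constructor
  · intro h
    obtain ⟨n, -, rfl⟩ := h.exists_pow_eq'
    exact ⟨_, hpow n x, n, rfl⟩
  · rintro ⟨y, rfl, h⟩
    obtain ⟨n, -, rfl⟩ := h.exists_pow_eq'
    exact ⟨n, hpow n x⟩

theorem corner_eq_corner_iff {α : Type*} {right up : Perm α} {x y : α} :
    corner right up x = corner right up y ↔ (turnAround right up).SameCycle x y :=
  Quotient.eq (r := Perm.SameCycle.setoid (turnAround right up))

/-! ### Framed surfaces and their realization -/

namespace SquareTiledSurface

variable {r : ℕ} {m : Fin r → ℕ} {E : Type*}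

/-- An identification of `E` with the set of horizontal saddle connections such that `σ` and `ω`
give the next saddle connection to the right along the bottom, resp. the top of the cylinders. -/
structure IsFraming (σ ω : Perm E) (S : SquareTiledSurface m) (f : E → Fin S.area) : Prop where
  isReturn : ∃ ℓ, IsReturn S.right f ℓ σ
  range_eq : Set.range f = S.critical
  turn : ∀ y, turnAround S.right S.up (f (σ y)) = f (ω y)

namespace IsFraming

variable {σ ω : Perm E} {S : SquareTiledSurface m} {f : E → Fin S.area}

theorem injective (hf : IsFraming σ ω S f) : Function.Injective f := hf.isReturn.choose_spec.inj

theorem mem_critical (hf : IsFraming σ ω S f) (y : E) : f y ∈ S.critical :=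
  hf.range_eq ▸ Set.mem_range_self y

theorem exists_isOneCylinderTiling [Finite E] [Nonempty E] (hf : IsFraming σ ω S f)
    (hσ : ∀ x y, σ.SameCycle x y) {ℓ : E → ℕ} (hℓ : IsReturn S.right f ℓ σ) :
    ∃ h π, 0 < h ∧ IsOneCylinderTiling σ ω S.right S.up f ℓ h π :=
  _root_.exists_isOneCylinderTiling hσ hℓ hf.turn
    (fun x hx => S.angle_other x (by rw [hf.range_eq] at hx; exact hx)) S.connected

/-- The numbering of the vertices determined by the numbering of the zeroes. -/
theorem exists_label (hf : IsFraming σ ω S f) :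
    ∃ lab : E → Fin r, ∀ y, corner S.right S.up (f y) = S.zero (lab y) :=
  ⟨fun y => (hf.mem_critical y).choose, fun y => (hf.mem_critical y).choose_spec.symm⟩

theorem corner_eq_iff (hf : IsFraming σ ω S f) {lab : E → Fin r}
    (hlab : ∀ y, corner S.right S.up (f y) = S.zero (lab y)) (i : Fin r) (x : Fin S.area) :
    corner S.right S.up x = S.zero i ↔ ∃ y, x = f y ∧ lab y = i := by
  constructor
  · intro h
    have : x ∈ S.critical := ⟨i, h.symm⟩
    rw [← hf.range_eq] at this
    obtain ⟨y, rfl⟩ := this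
    exact ⟨y, rfl, S.zero_injective ((hlab y).symm.trans h)⟩
  · rintro ⟨y, rfl, rfl⟩
    exact hlab y

theorem isLabelling [Finite E] (hf : IsFraming σ ω S f) {lab : E → Fin r}
    (hlab : ∀ y, corner S.right S.up (f y) = S.zero (lab y)) :
    IsLabelling (ω * σ⁻¹) m lab := by
  refine ⟨fun x y => ?_, fun i => ?_⟩
  · rw [← S.zero_injective.eq_iff, ← hlab, ← hlab, corner_eq_corner_iff,
      sameCycle_iff_of_semiconj (κ := ω * σ⁻¹)]
    · exact ⟨fun ⟨z, hz, h⟩ => hf.injective hz ▸ h, fun h => ⟨y, rfl, h⟩⟩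
    · intro y
      obtain ⟨y, rfl⟩ := σ.surjective y
      rw [hf.turn, Perm.mul_apply]
      simp
  · rw [← S.angle_zero i, ← Set.ncard_image_of_injective _ hf.injective]
    congr 1
    ext x
    rw [Set.mem_ofPred_eq, hf.corner_eq_iff hlab]
    exact ⟨fun ⟨y, h1, h2⟩ => ⟨y, h2.symm, h1⟩, fun ⟨y, h1, h2⟩ => ⟨y, h2, h1.symm⟩⟩

end IsFraming

/-- Two framed surfaces with isomorphic tilings and the same numbering of the zeroes are
isomorphic. -/
theorem isomorphic_of_isOneCylinderTiling {σ ω : Perm E} {S T : SquareTiledSurface m}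
    {f : E → Fin S.area} {f' : E → Fin T.area} (hf : IsFraming σ ω S f) (hf' : IsFraming σ ω T f')
    {ℓ : E → ℕ} {h : ℕ} {π : Perm (Tower ℓ)} (H : IsOneCylinderTiling σ ω S.right S.up f ℓ h π)
    (H' : IsOneCylinderTiling σ ω T.right T.up f' ℓ h π) {lab : E → Fin r}
    (hlab : ∀ y, corner S.right S.up (f y) = S.zero (lab y))
    (hlab' : ∀ y, corner T.right T.up (f' y) = T.zero (lab y)) : Isomorphic S T := by
  obtain ⟨e, h1, h2, h3⟩ := H.exists_equiv H'
  refine ⟨e, h1, h2, fun i x => ?_⟩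
  rw [hf.corner_eq_iff hlab, hf'.corner_eq_iff hlab']
  refine exists_congr fun y => and_congr_left fun _ => ?_
  rw [← h3, e.injective.eq_iff]

theorem exists_framing_of_isomorphic {σ ω : Perm E} {S T : SquareTiledSurface m}
    (h : Isomorphic S T) {f : E → Fin S.area} (hf : IsFraming σ ω S f) {ℓ : E → ℕ} {n : ℕ}
    {π : Perm (Tower ℓ)} (H : IsOneCylinderTiling σ ω S.right S.up f ℓ n π) {lab : E → Fin r}
    (hlab : ∀ y, corner S.right S.up (f y) = S.zero (lab y)) :
    ∃ f' : E → Fin T.area, IsFraming σ ω T f' ∧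
      IsOneCylinderTiling σ ω T.right T.up f' ℓ n π ∧
      ∀ y, corner T.right T.up (f' y) = T.zero (lab y) := by
  obtain ⟨e, h1, h2, h3⟩ := h
  have H' := H.comp e h1 h2
  refine ⟨e ∘ f, ⟨⟨ℓ, H'.isReturn⟩, ?_, H'.turnAround_base⟩, H', fun y => (h3 _ _).1 (hlab y)⟩
  ext x
  obtain ⟨x, rfl⟩ := e.surjective x
  have : x ∈ Set.range f ↔ e x ∈ T.critical := by
    rw [hf.range_eq]
    exact exists_congr fun i => eq_comm.trans ((h3 i x).trans eq_comm)
  rw [← this]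
  simp

/-- Realization of combinatorial data by a square-tiled surface. -/
theorem exists_surface {σ ω : Perm E} [Finite E] [Nonempty E] (hσ : ∀ x y, σ.SameCycle x y)
    {ℓ : E → ℕ} (hℓ : ∀ y, 0 < ℓ y) {h : ℕ} (hh : 0 < h) {π : Perm (Tower ℓ)}
    (hπ : ∀ b, π (towerShift ℓ hℓ σ b) = towerShift ℓ hℓ ω (π b)) {lab : E → Fin r}
    (hlab : IsLabelling (ω * σ⁻¹) m lab) :
    ∃ (S : SquareTiledSurface m) (f : E → Fin S.area), IsFraming σ ω S f ∧
      IsOneCylinderTiling σ ω S.right S.up f ℓ h π ∧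
      ∀ y, corner S.right S.up (f y) = S.zero (lab y) := by
  obtain ⟨right₀, up₀, f₀, H₀⟩ := exists_isOneCylinderTiling_of_gluing (ω := ω) hℓ hh hπ
  let e := Finite.equivFin (Tower fun _ : Tower ℓ => h)
  obtain ⟨right, up, f, H⟩ : ∃ (right up : Perm (Fin (Nat.card (Tower fun _ : Tower ℓ => h))))
      (f : E → Fin (Nat.card (Tower fun _ : Tower ℓ => h))),
      IsOneCylinderTiling σ ω right up f ℓ h π :=
    ⟨e.permCongr right₀, e.permCongr up₀, _, H₀.comp e (by simp) (by simp)⟩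
  have hT : ∀ y, turnAround right up (f y) = f ((ω * σ⁻¹) y) := fun y => by
    obtain ⟨y, rfl⟩ := σ.surjective y
    rw [H.turnAround_base, Perm.mul_apply]
    simp
  have hsurj : ∀ i, ∃ y, lab y = i := fun i => by
    have h1 := hlab.2 i
    obtain ⟨y, hy⟩ := Set.nonempty_of_ncard_ne_zero (s := {x | lab x = i}) (by omega)
    exact ⟨y, hy⟩
  -- The `i`-th zero is the left end of any saddle connection with label `i`; `hcorner` shows that
  -- the choice does not matter.
  choose z hz using hsurj
  have hcorner : ∀ x i, corner right up x = corner right up (f (z i)) ↔ ∃ y, x = f y ∧ lab y = i := by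
    intro x i
    rw [eq_comm, corner_eq_corner_iff, sameCycle_iff_of_semiconj hT]
    refine exists_congr fun y => and_congr_right fun _ => ?_
    rw [← hlab.1, hz, eq_comm]
  let S : SquareTiledSurface m :=
    { area := Nat.card (Tower fun _ : Tower ℓ => h)
      area_pos := (f (Classical.arbitrary E)).pos
      right := right
      up := up
      connected := H.exists_closure_apply_eq hσ
      zero := fun i => corner right up (f (z i))
      zero_injective := fun i j hij => by
        obtain ⟨y, hy, hy'⟩ := (hcorner _ _).1 hij
        rw [← hy', ← H.isReturn.inj hy, hz]
      angle_zero := fun i => by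
        rw [← hlab.2 i, ← Set.ncard_image_of_injective _ H.isReturn.inj]
        congr 1
        ext x
        rw [Set.mem_ofPred_eq, hcorner]
        exact ⟨fun ⟨y, h1, h2⟩ => ⟨y, h2, h1.symm⟩, fun ⟨y, h1, h2⟩ => ⟨y, h2.symm, h1⟩⟩
      angle_other := fun x hx => H.turnAround_of_notMem (by
        rintro ⟨y, rfl⟩
        exact hx ⟨lab y, ((hcorner _ _).2 ⟨y, rfl, rfl⟩).symm⟩) }
  refine ⟨S, f, ⟨⟨ℓ, H.isReturn⟩, ?_, H.turnAround_base⟩, H,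
    fun y => (hcorner _ _).2 ⟨y, rfl, rfl⟩⟩
  ext x
  constructor
  · rintro ⟨y, rfl⟩
    exact ⟨lab y, ((hcorner _ _).2 ⟨y, rfl, rfl⟩).symm⟩
  · rintro ⟨i, hi⟩
    obtain ⟨y, rfl, -⟩ := (hcorner x i).1 hi.symm
    exact ⟨y, rfl⟩

end SquareTiledSurface

/-! ### Framings as isomorphisms with the critical graph -/

namespace SquareTiledSurface

variable {r : ℕ} {m : Fin r → ℕ} {H : Type*}

theorem sameCylinder_of_isOneCylinderTiling {E : Type*} [Finite E] {σ ω : Perm E}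
    (hσ : ∀ x y, σ.SameCycle x y) {S : SquareTiledSurface m} {f : E → Fin S.area}
    (hf : IsFraming σ ω S f) {ℓ : E → ℕ} {h : ℕ} {π : Perm (Tower ℓ)}
    (hS : IsOneCylinderTiling σ ω S.right S.up f ℓ h π) (x y : Fin S.area) : S.SameCylinder x y := by
  have hrefl : ∀ x, S.SameCylinder x x := fun x => Relation.EqvGen.refl x
  have htrans : ∀ x y z, S.SameCylinder x y → S.SameCylinder y z → S.SameCylinder x z :=
    fun x y z => Relation.EqvGen.trans x y z
  have hsymm : ∀ x y, S.SameCylinder x y → S.SameCylinder y x := fun x y => Relation.EqvGen.symm x y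
  have hbase : ∀ b c, S.SameCylinder (climb S.right f ℓ b) (climb S.right f ℓ c) := fun b c =>
    sameCycle_rel (R := fun b c => S.SameCylinder (climb S.right f ℓ b) (climb S.right f ℓ c))
      (fun _ => hrefl _) (fun _ _ _ => htrans _ _ _)
      (fun b => Relation.EqvGen.rel _ _ (Or.inl (hS.isReturn.climb_shift b)))
      (towerShift_transitive hS.isReturn.pos σ hσ b c)
  have hup : ∀ b j, j < h →
      S.SameCylinder (climb S.right f ℓ b) ((S.up ^ j) (climb S.right f ℓ b)) := by
    intro b j
    induction j with
    | zero => exact fun _ => hrefl _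
    | succ j ih =>
      intro hj
      -- A zero on a row strictly inside the cylinder would put a square of the bottom row there,
      -- before the first return of `up`.
      refine htrans _ _ _ (ih (by omega)) (Relation.EqvGen.rel _ _ (Or.inr ⟨?_, fun z hz hzc => ?_⟩))
      · rw [pow_succ', Perm.mul_apply]
      · rw [← hf.range_eq] at hz
        obtain ⟨y, rfl⟩ := hz
        have key := sameCycle_rel (R := fun u v => (∃ c, u = (S.up ^ (j + 1)) (climb S.right f ℓ c)) →
          ∃ c, v = (S.up ^ (j + 1)) (climb S.right f ℓ c)) (fun _ => id)
          (fun _ _ _ h1 h2 h => h2 (h1 h))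
          (by
            rintro _ ⟨c, rfl⟩
            exact ⟨_, hS.right_climb c _ hj⟩) hzc ⟨b, rfl⟩
        obtain ⟨c, hc⟩ := key
        exact hS.isReturn_up.ne c _ j.succ_pos hj (towerBase ℓ hS.isReturn.pos y) hc.symm
  obtain ⟨⟨⟨b, j⟩, hj⟩, rfl⟩ := hS.surjective x
  obtain ⟨⟨⟨c, k⟩, hk⟩, rfl⟩ := hS.surjective y
  exact htrans _ _ _ (hsymm _ _ (hup b j hj)) (htrans _ _ _ (hbase b c) (hup c k hk))

/-- Isomorphisms between the ribbon graph of `D` and the critical graph of `S`. -/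
def graphIsos (D : SeparatrixDiagram H) (S : SquareTiledSurface m) : Set (H ≃ S.critical × Bool) :=
  {e | (∀ x, e (D.next x) = S.criticalGraph.next (e x)) ∧
    (∀ x, e (D.flip x) = S.criticalGraph.flip (e x)) ∧
    ∀ x, S.criticalGraph.isOut (e x) ↔ D.isOut x}

variable {D : SeparatrixDiagram H} {S : SquareTiledSurface m}

theorem graphIsos_apply_out {e : H ≃ S.critical × Bool} (he : e ∈ graphIsos D S) (y : D.Edge) :
    e y = ((e y).1, true) := Prod.ext rfl ((he.2.2 y).2 y.2)

theorem graphIsos_apply_flip {e : H ≃ S.critical × Bool} (he : e ∈ graphIsos D S) (y : D.Edge) :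
    e (D.flip y) = ((e y).1, false) := by
  rw [he.2.1, graphIsos_apply_out he y]
  rfl

theorem saddleEnd_eq_iff {x y : S.critical} :
    S.saddleEnd x = y ↔ (S.right ^ returnTime S.right S.critical x) (x : Fin S.area) = y :=
  Subtype.ext_iff

theorem isFraming_of_mem_graphIsos (hor : D.IsOrientable) {e : H ≃ S.critical × Bool}
    (he : e ∈ graphIsos D S) :
    IsFraming (D.bottomPerm hor) (D.topPerm hor) S (fun y => ((e y).1 : Fin S.area)) := by
  have hinj : Function.Injective (fun y : D.Edge => ((e y).1 : Fin S.area)) := fun x y hxy => by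
    apply Subtype.ext
    apply e.injective
    rw [graphIsos_apply_out he x, graphIsos_apply_out he y, Subtype.ext hxy]
  have hσ : ∀ y : D.Edge, S.saddleEnd (e y).1 = (e (D.bottomPerm hor y)).1 := fun y => by
    have h1 := he.1 (D.bottomPerm hor y)
    rw [D.next_bottomPerm, graphIsos_apply_flip he,
      graphIsos_apply_out he (D.bottomPerm hor y)] at h1
    have h2 : (e y).1 = S.saddleEnd.symm (e (D.bottomPerm hor y)).1 := congrArg Prod.fst h1
    rw [h2, Equiv.apply_symm_apply]
  refine ⟨⟨fun y => returnTime S.right S.critical (e y).1, hinj, fun y => returnTime_pos _ _ _,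
    fun y => saddleEnd_eq_iff.1 (hσ y), fun y k hk hk' z hz => ?_⟩, ?_, fun y => ?_⟩
  · exact absurd (returnTime_le _ _ (e y).1 hk (hz ▸ (e z).1.2)) (not_le.2 hk')
  · ext x
    constructor
    · rintro ⟨y, rfl⟩
      exact (e y).1.2
    · intro hx
      have h1 := he.2.2 (e.symm (⟨x, hx⟩, true))
      rw [Equiv.apply_symm_apply] at h1
      exact ⟨⟨e.symm (⟨x, hx⟩, true), h1.1 rfl⟩, by simp⟩
  · have h1 := he.1 (D.flip y)
    rw [graphIsos_apply_flip he, ← D.coe_topPerm hor, graphIsos_apply_out he (D.topPerm hor y)] at h1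
    have h2 : (e (D.topPerm hor y)).1 = S.turn (S.saddleEnd (e y).1) := congrArg Prod.fst h1
    rw [hσ] at h2
    exact (congrArg Subtype.val h2).symm

open Classical in
/-- A half-edge is given by its edge and its direction. -/
noncomputable def _root_.SeparatrixDiagram.halfEdgeEquiv (D : SeparatrixDiagram H) :
    H ≃ D.Edge × Bool where
  toFun x := if h : D.isOut x then (⟨x, h⟩, true) else (⟨D.flip x, (D.isOut_flip x).2 h⟩, false)
  invFun p := if p.2 then p.1 else D.flip p.1
  left_inv x := by
    by_cases h : D.isOut x <;> simp [h, D.flip_flip]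
  right_inv p := by
    obtain ⟨⟨x, hx⟩, _ | _⟩ := p <;> simp [hx, D.isOut_flip, D.flip_flip]

theorem exists_graphIso_of_isFraming (hor : D.IsOrientable) {f : D.Edge → Fin S.area}
    (hf : IsFraming (D.bottomPerm hor) (D.topPerm hor) S f) :
    ∃ e ∈ graphIsos D S, ∀ y : D.Edge, ((e y).1 : Fin S.area) = f y := by
  let φ : D.Edge ≃ S.critical :=
    (Equiv.ofInjective f hf.injective).trans (Equiv.setCongr hf.range_eq)
  have hφ : ∀ y, (φ y : Fin S.area) = f y := fun y => rfl
  obtain ⟨ℓ, hℓ⟩ := hf.isReturn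
  have hσ : ∀ y, S.saddleEnd (φ y) = φ (D.bottomPerm hor y) := fun y => by
    have hle := returnTime_le S.right S.critical (φ y) (hℓ.pos y) (by
      rw [hφ, hℓ.ret]
      exact hf.mem_critical _)
    have heq : returnTime S.right S.critical (φ y) = ℓ y := by
      refine le_antisymm hle (not_lt.1 fun hlt => ?_)
      have hmem := returnTime_mem S.right S.critical (φ y)
      obtain ⟨z, hz⟩ := hf.range_eq.ge hmem
      exact hℓ.ne y _ (returnTime_pos _ _ _) hlt z hz.symm
    rw [saddleEnd_eq_iff, heq]
    exact hℓ.ret y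
  have hω : ∀ y, S.turn (S.saddleEnd (φ y)) = φ (D.topPerm hor y) := fun y => by
    rw [hσ]
    exact Subtype.ext (hf.turn y)
  let κ := D.halfEdgeEquiv
  have hκt : ∀ y : D.Edge, κ y = (y, true) := fun y => dif_pos y.2
  have hκf : ∀ y : D.Edge, κ (D.flip y) = (y, false) := fun y => by
    have : κ.symm (y, false) = D.flip y := rfl
    rw [← this, Equiv.apply_symm_apply]
  let e : H ≃ S.critical × Bool := κ.trans (φ.prodCongr (Equiv.refl Bool))
  have het : ∀ y : D.Edge, e y = (φ y, true) := fun y =>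
    congrArg (φ.prodCongr (Equiv.refl Bool)) (hκt y)
  have hef : ∀ y : D.Edge, e (D.flip y) = (φ y, false) := fun y =>
    congrArg (φ.prodCongr (Equiv.refl Bool)) (hκf y)
  have hcases : ∀ x : H, ∃ y : D.Edge, x = y ∨ x = D.flip y := fun x => by
    by_cases hx : D.isOut x
    · exact ⟨⟨x, hx⟩, Or.inl rfl⟩
    · exact ⟨⟨D.flip x, (D.isOut_flip x).2 hx⟩, Or.inr (D.flip_flip x).symm⟩
  refine ⟨e, ⟨fun x => ?_, fun x => ?_, fun x => ?_⟩, fun y => by rw [het, ← hφ]⟩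
  · obtain ⟨y, rfl | rfl⟩ := hcases x
    · obtain ⟨y, rfl⟩ := (D.bottomPerm hor).surjective y
      rw [D.next_bottomPerm, hef, het]
      refine Prod.ext (S.saddleEnd.injective ?_) rfl
      rw [hσ]
      exact (S.saddleEnd.apply_symm_apply _).symm
    · rw [← D.coe_topPerm hor, het, hef, ← hω]
      rfl
  · obtain ⟨y, rfl | rfl⟩ := hcases x
    · rw [hef, het]
      rfl
    · rw [D.flip_flip, hef, het]
      rfl
  · obtain ⟨y, rfl | rfl⟩ := hcases x
    · rw [het]
      exact iff_of_true rfl y.2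
    · rw [hef, D.isOut_flip]
      exact iff_of_false (by simp [criticalGraph]) (not_not.2 y.2)

/-- The condition on cylinders is automatic: all squares lie in one cylinder, and any two distinct
boundary components of `D` are partners. -/
theorem hasDiagram_iff_exists_isFraming [Finite H] (hor : D.IsOrientable) (hone : D.IsOneCylinder) :
    S.HasDiagram D ↔ ∃ f, IsFraming (D.bottomPerm hor) (D.topPerm hor) S f := by
  constructor
  · rintro ⟨e, h1, h2, h3, -⟩
    exact ⟨_, isFraming_of_mem_graphIsos hor ⟨h1, h2, h3⟩⟩
  · rintro ⟨f, hf⟩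
    obtain ⟨e, he, -⟩ := exists_graphIso_of_isFraming hor hf
    obtain ⟨ℓ, hℓ⟩ := hf.isReturn
    have := D.nonempty_edge hone
    have hσ := D.bottomPerm_sameCycle hor hone
    obtain ⟨h, π, -, hS⟩ := hf.exists_isOneCylinderTiling hσ hℓ
    refine ⟨e, he.1, he.2.1, he.2.2, fun x y hxy => iff_of_true ?_
      (sameCylinder_of_isOneCylinderTiling hσ hf hS _ _)⟩
    rw [D.partner_boundary_iff hor hone, ← D.boundary_eq_iff_isOut hor hone]
    exact hxy

theorem comp_mem_graphIsos {s : Perm H} (hs : s ∈ D.symmetryGroup) {e : H ≃ S.critical × Bool}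
    (he : e ∈ graphIsos D S) : s.trans e ∈ graphIsos D S := by
  obtain ⟨h1, h2, h3, -⟩ := hs
  refine ⟨fun x => ?_, fun x => ?_, fun x => ?_⟩
  · simp [h1, he.1]
  · simp [h2, he.2.1]
  · simp [he.2.2, h3]

theorem trans_symm_mem_symmetryGroup [Finite H] (hor : D.IsOrientable) (hone : D.IsOneCylinder)
    {e e' : H ≃ S.critical × Bool} (he : e ∈ graphIsos D S) (he' : e' ∈ graphIsos D S) :
    e.trans e'.symm ∈ D.symmetryGroup := by
  have h3 : ∀ x, D.isOut ((e.trans e'.symm) x) ↔ D.isOut x := fun x => by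
    rw [← he'.2.2, Equiv.trans_apply, Equiv.apply_symm_apply, he.2.2]
  refine ⟨fun x => ?_, fun x => ?_, h3, fun x y => ?_⟩
  · simp [Equiv.symm_apply_eq, he.1, he'.1]
  · simp [Equiv.symm_apply_eq, he.2.1, he'.2.1]
  · rw [D.partner_boundary_iff hor hone, D.partner_boundary_iff hor hone, h3, h3]

/-- The framings of a surface with diagram `D` form a torsor under the symmetry group of `D`. -/
theorem card_framings [Finite H] (hor : D.IsOrientable) (hone : D.IsOneCylinder)
    (hS : S.HasDiagram D) :
    {f | IsFraming (D.bottomPerm hor) (D.topPerm hor) S f}.ncard = Nat.card D.symmetryGroup := by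
  obtain ⟨e₀, h1, h2, h3, -⟩ := hS
  have he₀ : e₀ ∈ graphIsos D S := ⟨h1, h2, h3⟩
  rw [← Nat.card_coe_set_eq]
  symm
  refine Nat.card_congr (Equiv.ofBijective (fun s : D.symmetryGroup =>
    ⟨fun y => (((s : Perm H).trans e₀) y).1,
      isFraming_of_mem_graphIsos hor (comp_mem_graphIsos s.2 he₀)⟩) ⟨fun s t hst => ?_, ?_⟩)
  · have hst' := fun y => congrFun (Subtype.ext_iff.1 hst) y
    have hes := comp_mem_graphIsos s.2 he₀
    have het := comp_mem_graphIsos t.2 he₀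
    refine Subtype.ext (Equiv.ext fun x => e₀.injective ?_)
    change ((s : Perm H).trans e₀) x = ((t : Perm H).trans e₀) x
    by_cases hx : D.isOut x
    · rw [graphIsos_apply_out hes ⟨x, hx⟩, graphIsos_apply_out het ⟨x, hx⟩]
      exact Prod.ext (Subtype.ext (hst' ⟨x, hx⟩)) rfl
    · have hx' := (D.isOut_flip x).2 hx
      have a := graphIsos_apply_flip hes ⟨_, hx'⟩
      have b := graphIsos_apply_flip het ⟨_, hx'⟩
      rw [D.flip_flip] at a b
      rw [a, b]
      exact Prod.ext (Subtype.ext (hst' ⟨_, hx'⟩)) rfl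
  · rintro ⟨f, hf⟩
    obtain ⟨e, he, hef⟩ := exists_graphIso_of_isFraming hor hf
    refine ⟨⟨e.trans e₀.symm, trans_symm_mem_symmetryGroup hor hone he he₀⟩, Subtype.ext ?_⟩
    funext y
    simp [← hef]

end SquareTiledSurface

/-! ### Comparing framed surfaces with their parameters -/

theorem card_bounds_of_fibers {Q X : Type*} {F : Q → Type*} [Finite X] {k : ℕ} (hk : 0 < k)
    (hF : ∀ q, Nat.card (F q) = k) {Ψ : (Σ q, F q) → X} (hsurj : Function.Surjective Ψ)
    (hfst : ∀ p p', Ψ p = Ψ p' → p.1 = p'.1) (B : Set X)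
    (hinj : ∀ p p', Ψ p = Ψ p' → Ψ p ∉ B → p = p') :
    Nat.card X ≤ k * Nat.card Q ∧ k * Nat.card Q ≤ Nat.card X + k * B.ncard := by
  classical
  have hne : ∀ q, Nonempty (F q) := fun q => (Nat.card_pos_iff.1 (hF q ▸ hk)).1
  have hfin : ∀ q, Finite (F q) := fun q => (Nat.card_pos_iff.1 (hF q ▸ hk)).2
  have : Finite Q := Finite.of_injective (fun q => Ψ ⟨q, (hne q).some⟩) fun q q' h => hfst _ _ h
  have := Fintype.ofFinite Q
  have := Fintype.ofFinite X
  have := fun q => Fintype.ofFinite (F q)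
  have hP : Nat.card (Σ q, F q) = k * Nat.card Q := by
    rw [Nat.card_sigma, Finset.sum_congr rfl fun q _ => hF q]
    simp [mul_comm]
  rw [← hP]
  refine ⟨Nat.card_le_card_of_surjective Ψ hsurj, ?_⟩
  -- A fibre of `Ψ` lies over one `q`, hence has at most `k` points, and only one outside `B`;
  -- summing over `X` gives the upper bound.
  have hfib : ∀ x, (Finset.univ.filter fun p => Ψ p = x).card ≤ k := fun x => by
    obtain ⟨⟨q, f⟩, rfl⟩ := hsurj x
    have hsub : (Finset.univ.filter fun p => Ψ p = Ψ ⟨q, f⟩) ⊆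
        Finset.univ.image fun g : F q => (⟨q, g⟩ : Σ q, F q) := by
      rintro ⟨q', g⟩ hp
      obtain rfl : q' = q := hfst _ _ (Finset.mem_filter.1 hp).2
      exact Finset.mem_image_of_mem _ (Finset.mem_univ g)
    refine (Finset.card_le_card hsub).trans (Finset.card_image_le.trans ?_)
    rw [Finset.card_univ, ← Nat.card_eq_fintype_card, hF]
  have hfib' : ∀ x ∉ B, (Finset.univ.filter fun p => Ψ p = x).card ≤ 1 := fun x hx => by
    refine Finset.card_le_one.2 fun p hp p' hp' => ?_
    obtain rfl := (Finset.mem_filter.1 hp).2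
    exact hinj _ _ (Finset.mem_filter.1 hp').2.symm hx
  calc Nat.card (Σ q, F q)
      = ∑ x, (Finset.univ.filter fun p => Ψ p = x).card := by
        rw [Nat.card_eq_fintype_card, ← Finset.card_univ]
        exact Finset.card_eq_sum_card_fiberwise fun _ _ => Finset.mem_coe.2 (Finset.mem_univ _)
    _ ≤ ∑ x, (1 + if x ∈ B then k else 0) := Finset.sum_le_sum fun x _ => by
        by_cases hx : x ∈ B
        · simp only [hx, if_true]
          exact (hfib x).trans (Nat.le_add_left _ _)
        · simpa [hx] using hfib' x hx
    _ = Nat.card X + k * B.ncard := by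
        rw [Finset.sum_add_distrib, ← Finset.sum_filter]
        have : B.ncard = (Finset.univ.filter fun x => x ∈ B).card := by
          rw [Set.ncard_eq_toFinset_card']
          congr 1
          ext x
          simp
        simp [this, mul_comm]

theorem IsReturn.height_eq_of_range_eq {ι α : Type*} {p : Perm α} {g g' : ι → α} {ℓ ℓ' : ι → ℕ}
    {s s' : Perm ι} (h : IsReturn p g ℓ s) (h' : IsReturn p g' ℓ' s')
    (hr : Set.range g = Set.range g') {i j : ι} (hij : g i = g' j) : ℓ i = ℓ' j := by
  rcases lt_trichotomy (ℓ i) (ℓ' j) with hlt | heq | hlt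
  · obtain ⟨z, hz⟩ := hr.le ⟨s i, rfl⟩
    exact absurd (by rw [← hij, h.ret, hz]) (h'.ne j _ (h.pos i) hlt z)
  · exact heq
  · obtain ⟨z, hz⟩ := hr.ge ⟨s' j, rfl⟩
    exact absurd (by rw [hij, h'.ret, hz]) (h.ne i _ (h'.pos j) hlt z)

namespace SquareTiledSurface

/-- The lengths of the saddle connections, the height and the twist of a cylinder that are
realized by a surface of area at most `N`. -/
def cylinderParameters (E : Type*) [Fintype E] (N : ℕ) : Set ((E → ℕ) × ℕ × ℕ) :=
  {x | (∀ y, 0 < x.1 y) ∧ 0 < x.2.1 ∧ x.2.2 < ∑ y, x.1 y ∧ x.2.1 * ∑ y, x.1 y ≤ N}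

theorem cylinderParameters_finite (E : Type*) [Fintype E] (N : ℕ) :
    (cylinderParameters E N).Finite := by
  classical
  refine ((Fintype.piFinset fun _ : E => Finset.range (N + 1)) ×ˢ
    (Finset.range (N + 1) ×ˢ Finset.range (N + 1))).finite_toSet.subset ?_
  rintro ⟨ℓ, h, t⟩ ⟨h1, h2, h3, h4⟩
  simp only at h1 h2 h3 h4
  have hw : ∑ y, ℓ y ≤ N := le_trans (Nat.le_mul_of_pos_left _ h2) h4
  have hh : h ≤ N := le_trans (Nat.le_mul_of_pos_right _ (by omega)) h4
  have hl : ∀ y, ℓ y ≤ N := fun y =>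
    (Finset.single_le_sum (f := ℓ) (fun _ _ => Nat.zero_le _) (Finset.mem_univ y)).trans hw
  simp only [Finset.coe_product, Set.mem_prod, Finset.mem_coe, Fintype.mem_piFinset,
    Finset.mem_range]
  exact ⟨fun y => Nat.lt_succ_of_le (hl y), by omega, by omega⟩

variable {r : ℕ} {m : Fin r → ℕ} {E : Type*} [Fintype E] {σ ω : Perm E}

/-- The framed surface `(S, f)` has the given lengths, height and twist, and numbering of the
zeroes. -/
def HasParameters (σ ω : Perm E) (y₀ : E) (S : SquareTiledSurface m) (f : E → Fin S.area)
    (x : ((E → ℕ) × ℕ × ℕ) × (E → Fin r)) : Prop :=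
  IsFraming σ ω S f ∧ x.1.2.2 < ∑ y, x.1.1 y ∧
    (∀ y, corner S.right S.up (f y) = S.zero (x.2 y)) ∧
    ∃ (π : Perm (Tower x.1.1)) (H : IsOneCylinderTiling σ ω S.right S.up f x.1.1 x.1.2.1 π),
      π (towerBase _ H.isReturn.pos y₀) =
        (towerShift _ H.isReturn.pos σ ^ x.1.2.2) (towerBase _ H.isReturn.pos y₀)

variable {y₀ : E} {S T : SquareTiledSurface m} {f : E → Fin S.area} {f' : E → Fin T.area}
  {x x' : ((E → ℕ) × ℕ × ℕ) × (E → Fin r)}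

theorem IsFraming.exists_hasParameters (hσ : ∀ x y, σ.SameCycle x y) (hf : IsFraming σ ω S f)
    (y₀ : E) : ∃ x, HasParameters σ ω y₀ S f x := by
  have : Nonempty E := ⟨y₀⟩
  obtain ⟨ℓ, hℓ⟩ := hf.isReturn
  obtain ⟨h, π, hh, H⟩ := hf.exists_isOneCylinderTiling hσ hℓ
  obtain ⟨lab, hlab⟩ := hf.exists_label
  obtain ⟨t, ht, htw⟩ := exists_pow_apply_eq_of_transitive
    (towerShift_transitive H.isReturn.pos σ hσ) (towerBase _ H.isReturn.pos y₀)
    (π (towerBase _ H.isReturn.pos y₀))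
  rw [card_tower] at ht
  exact ⟨((ℓ, h, t), lab), hf, ht, hlab, π, H, htw.symm⟩

theorem HasParameters.unique (hσ : ∀ x y, σ.SameCycle x y)
    (hx : HasParameters σ ω y₀ S f x) (hx' : HasParameters σ ω y₀ S f x') : x = x' := by
  obtain ⟨⟨ℓ, h, t⟩, lab⟩ := x
  obtain ⟨⟨ℓ', h', t'⟩, lab'⟩ := x'
  obtain ⟨hf, ht, hlab, π, H, hπ⟩ := hx
  obtain ⟨-, ht', hlab', π', H', hπ'⟩ := hx'
  dsimp only at *
  obtain rfl := H.isReturn.height_unique H'.isReturn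
  obtain rfl : h = h' :=
    congrFun (H.isReturn_up.height_unique H'.isReturn_up) (towerBase ℓ H.isReturn.pos y₀)
  obtain rfl := H.isReturn_up.map_unique H'.isReturn_up
  obtain rfl : lab = lab' := funext fun y => S.zero_injective ((hlab y).symm.trans (hlab' y))
  obtain rfl : t = t' := pow_apply_injOn_of_transitive
    (towerShift_transitive H.isReturn.pos σ hσ) (by rwa [card_tower]) (by rwa [card_tower])
    (hπ.symm.trans hπ')
  rfl

/-- The twist gives the value of the gluing at the reference square over `y₀`, hence the whole
gluing, and the cylinder model then identifies the surfaces. -/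
theorem HasParameters.isomorphic (hσ : ∀ x y, σ.SameCycle x y)
    (hx : HasParameters σ ω y₀ S f x) (hx' : HasParameters σ ω y₀ T f' x) : Isomorphic S T := by
  obtain ⟨hf, -, hlab, π, H, hπ⟩ := hx
  obtain ⟨hf', -, hlab', π', H', hπ'⟩ := hx'
  obtain rfl := H.gluing_unique hσ H' (hπ.trans hπ'.symm)
  exact isomorphic_of_isOneCylinderTiling hf hf' H H' hlab hlab'

theorem HasParameters.exists_of_isomorphic (hx : HasParameters σ ω y₀ S f x)
    (hST : Isomorphic S T) : ∃ f', HasParameters σ ω y₀ T f' x := by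
  obtain ⟨hf, ht, hlab, π, H, hπ⟩ := hx
  obtain ⟨f', hf', H', hlab'⟩ := exists_framing_of_isomorphic hST hf H hlab
  exact ⟨f', hf', ht, hlab', π, H', hπ⟩

theorem HasParameters.mem (hx : HasParameters σ ω y₀ S f x) {N : ℕ} (hN : S.area ≤ N) :
    x ∈ cylinderParameters E N ×ˢ {lab | IsLabelling (ω * σ⁻¹) m lab} := by
  have : Nonempty E := ⟨y₀⟩
  obtain ⟨hf, ht, hlab, π, H, hπ⟩ := hx
  refine ⟨⟨H.isReturn.pos, H.height_pos, ht, ?_⟩, hf.isLabelling hlab⟩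
  rwa [← H.card_eq, Nat.card_eq_fintype_card, Fintype.card_fin]

theorem HasParameters.area_le (hx : HasParameters σ ω y₀ S f x) {N : ℕ}
    (hN : x.1 ∈ cylinderParameters E N) : S.area ≤ N := by
  obtain ⟨hf, ht, hlab, π, H, hπ⟩ := hx
  have := H.card_eq
  rw [Nat.card_eq_fintype_card, Fintype.card_fin] at this
  exact this.trans_le hN.2.2.2

/-- Saddle connections of distinct lengths are recognized by their lengths, which depend on the
surface only. -/
theorem HasParameters.framing_unique {f' : E → Fin S.area} (hx : HasParameters σ ω y₀ S f x)
    (hx' : HasParameters σ ω y₀ S f' x) (hinj : Function.Injective x.1.1) : f = f' := by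
  obtain ⟨hf, -, -, π, H, -⟩ := hx
  obtain ⟨hf', -, -, π', H', -⟩ := hx'
  have hr : Set.range f = Set.range f' := hf.range_eq.trans hf'.range_eq.symm
  funext y
  obtain ⟨z, hz⟩ := hr.le ⟨y, rfl⟩
  rw [← hz, hinj (H.isReturn.height_eq_of_range_eq H'.isReturn hr hz.symm)]

theorem exists_hasParameters (hσ : ∀ x y, σ.SameCycle x y) (hω : ∀ x y, ω.SameCycle x y) {N : ℕ}
    (y₀ : E) (hx : x ∈ cylinderParameters E N ×ˢ {lab | IsLabelling (ω * σ⁻¹) m lab}) :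
    ∃ (S : SquareTiledSurface m) (f : E → Fin S.area), HasParameters σ ω y₀ S f x := by
  have : Nonempty E := ⟨y₀⟩
  obtain ⟨⟨hℓ, hh, ht, hN⟩, hlab⟩ := hx
  obtain ⟨π, hπ, hπ₀⟩ := exists_perm_intertwining (towerShift_transitive hℓ σ hσ)
    (towerShift_transitive hℓ ω hω) (towerBase _ hℓ y₀)
    ((towerShift _ hℓ σ ^ x.1.2.2) (towerBase _ hℓ y₀))
  obtain ⟨S, f, hf, H, hl⟩ := exists_surface hσ hℓ hh hπ hlab
  exact ⟨S, f, hf, ht, hl, π, H, hπ₀⟩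

end SquareTiledSurface

open SquareTiledSurface in
/-- The number of surfaces, multiplied by the order of the symmetry group, differs from
the number of parameters at most by the contribution of the parameters with coinciding lengths. -/
theorem countSquareTiled_bounds {H : Type*} [Finite H] {D : SeparatrixDiagram H} [Fintype D.Edge]
    (hor : D.IsOrientable) (hone : D.IsOneCylinder) {r : ℕ} (m : Fin r → ℕ) (a : ℝ) (ha : 0 ≤ a) :
    (cylinderParameters D.Edge ⌊a⌋₊).ncard *
        {lab | IsLabelling (D.topPerm hor * (D.bottomPerm hor)⁻¹) m lab}.ncard ≤
      Nat.card D.symmetryGroup * countSquareTiled D m a ∧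
    Nat.card D.symmetryGroup * countSquareTiled D m a ≤
      (cylinderParameters D.Edge ⌊a⌋₊).ncard *
        {lab | IsLabelling (D.topPerm hor * (D.bottomPerm hor)⁻¹) m lab}.ncard +
      Nat.card D.symmetryGroup *
        ({x ∈ cylinderParameters D.Edge ⌊a⌋₊ | ¬ Function.Injective x.1}.ncard *
          {lab | IsLabelling (D.topPerm hor * (D.bottomPerm hor)⁻¹) m lab}.ncard) := by
  set σ := D.bottomPerm hor
  set ω := D.topPerm hor
  have hσ : ∀ x y, σ.SameCycle x y := D.bottomPerm_sameCycle hor hone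
  have hω : ∀ x y, ω.SameCycle x y := D.topPerm_sameCycle hor hone
  obtain ⟨y₀⟩ := D.nonempty_edge hone
  set N := ⌊a⌋₊
  set Λ : Set (D.Edge → Fin r) := {lab | IsLabelling (ω * σ⁻¹) m lab}
  let Q := {q : Quotient (isomorphismSetoid m) |
    ∃ S : SquareTiledSurface m, ⟦S⟧ = q ∧ (S.area : ℝ) ≤ a ∧ S.HasDiagram D}
  -- Parameters pass to isomorphic surfaces, so the chosen representative of a class inherits the
  -- area bound and the diagram.
  have hrep : ∀ q ∈ Q, q.out.area ≤ N ∧ q.out.HasDiagram D := by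
    rintro _ ⟨S, rfl, hS, hSD⟩
    obtain ⟨f, hf⟩ := (hasDiagram_iff_exists_isFraming hor hone).1 hSD
    obtain ⟨x, hx⟩ := hf.exists_hasParameters hσ y₀
    have hmem := hx.mem ((Nat.le_floor_iff ha).2 hS)
    obtain ⟨f', hx'⟩ := hx.exists_of_isomorphic (Setoid.symm (Quotient.mk_out S))
    exact ⟨hx'.area_le hmem.1, (hasDiagram_iff_exists_isFraming hor hone).2 ⟨f', hx'.1⟩⟩
  have hXfin : (cylinderParameters D.Edge N ×ˢ Λ).Finite :=
    (cylinderParameters_finite _ _).prod (Set.toFinite _)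
  have := hXfin.to_subtype
  have hpar : ∀ p : (Σ q : Q, {f | IsFraming σ ω q.1.out f}),
      ∃ x : (cylinderParameters D.Edge N ×ˢ Λ : Set _),
        HasParameters σ ω y₀ p.1.1.out p.2.1 x.1 := fun p => by
    obtain ⟨x, hx⟩ := IsFraming.exists_hasParameters hσ p.2.2 y₀
    exact ⟨⟨x, hx.mem (hrep _ p.1.2).1⟩, hx⟩
  -- `Ψ` sends a class with a framing of its representative to the parameters. It is onto by
  -- realization, and its value determines the class.
  choose Ψ hΨ using hpar
  have key := card_bounds_of_fibers (k := Nat.card D.symmetryGroup) Nat.card_pos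
    (fun q => (Nat.card_coe_set_eq _).trans (card_framings hor hone (hrep _ q.2).2))
    (Ψ := Ψ) ?_ ?_ {x | ¬ Function.Injective x.1.1.1} ?_
  · have hX : Nat.card (cylinderParameters D.Edge N ×ˢ Λ : Set _) =
        (cylinderParameters D.Edge N).ncard * Λ.ncard := by
      rw [Nat.card_coe_set_eq, Set.ncard_prod]
    have hB : ({x | ¬ Function.Injective x.1.1.1} :
        Set (cylinderParameters D.Edge N ×ˢ Λ : Set _)).ncard =
        {x ∈ cylinderParameters D.Edge N | ¬ Function.Injective x.1}.ncard * Λ.ncard := by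
      rw [← Set.ncard_prod, ← Set.ncard_image_of_injective _ Subtype.val_injective]
      congr 1
      ext ⟨x, l⟩
      constructor
      · rintro ⟨⟨_, h1, h2⟩, h3, rfl⟩
        exact ⟨⟨h1, h3⟩, h2⟩
      · rintro ⟨⟨h1, h3⟩, h2⟩
        exact ⟨⟨_, h1, h2⟩, h3, rfl⟩
    rwa [hX, hB, Nat.card_coe_set_eq] at key
  · rintro ⟨x, hx⟩
    obtain ⟨S, f, hS⟩ := exists_hasParameters hσ hω y₀ hx
    have hq : (⟦S⟧ : Quotient (isomorphismSetoid m)) ∈ Q :=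
      ⟨S, rfl, (Nat.le_floor_iff ha).1 (hS.area_le hx.1),
        (hasDiagram_iff_exists_isFraming hor hone).2 ⟨f, hS.1⟩⟩
    obtain ⟨f', hf'⟩ := hS.exists_of_isomorphic (Setoid.symm (Quotient.mk_out S))
    exact ⟨⟨⟨_, hq⟩, ⟨f', hf'.1⟩⟩, Subtype.ext ((hΨ _).unique hσ hf')⟩
  · intro p p' h
    have h' := hΨ p'
    rw [← h] at h'
    exact Subtype.ext (Quotient.out_equiv_out.1 ((hΨ p).isomorphic hσ h'))
  · rintro ⟨q, f⟩ ⟨q', f'⟩ h hB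
    have h' := hΨ ⟨q', f'⟩
    rw [← h] at h'
    obtain rfl : q = q' := Subtype.ext (Quotient.out_equiv_out.1 ((hΨ ⟨q, f⟩).isomorphic hσ h'))
    obtain rfl : f = f' := Subtype.ext ((hΨ ⟨q, f⟩).framing_unique h' (not_not.1 hB))
    rfl

/-! ### Counting the numberings of the zeroes -/

namespace IsLabelling

variable {E : Type*} {κ : Perm E} {r : ℕ} {m : Fin r → ℕ} {lab : E → Fin r}

theorem surjective (h : IsLabelling κ m lab) : Function.Surjective lab := fun i => by
  have h1 := h.2 i
  obtain ⟨y, hy⟩ := Set.nonempty_of_ncard_ne_zero (s := {x | lab x = i}) (by omega)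
  exact ⟨y, hy⟩

theorem card_eq [Fintype E] (h : IsLabelling κ m lab) : Fintype.card E = ∑ i, (m i + 1) := by
  classical
  rw [← Finset.card_univ, Finset.card_eq_sum_card_fiberwise (f := lab) (t := Finset.univ)
    fun _ _ => Finset.mem_coe.2 (Finset.mem_univ _)]
  refine Finset.sum_congr rfl fun i _ => ?_
  rw [← h.2 i, Set.ncard_eq_toFinset_card']
  congr 1
  ext x
  simp

theorem perm_comp (h : IsLabelling κ m lab) {g : Perm (Fin r)} (hg : m ∘ g = m) :
    IsLabelling κ m (g ∘ lab) := by
  refine ⟨fun x y => by rw [← h.1]; exact g.injective.eq_iff, fun i => ?_⟩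
  have h1 := h.2 (g.symm i)
  have h2 : m (g.symm i) = m i := by simpa using congrFun hg.symm (g.symm i)
  rw [h2] at h1
  rw [← h1]
  congr 1
  ext x
  simp [Equiv.eq_symm_apply]

theorem exists_perm (h : IsLabelling κ m lab) {lab' : E → Fin r} (h' : IsLabelling κ m lab') :
    ∃ g : Perm (Fin r), m ∘ g = m ∧ g ∘ lab = lab' := by
  choose z hz using h.surjective
  have hcomp : ∀ x, lab' (z (lab x)) = lab' x := fun x => by rw [h'.1, ← h.1, hz]
  have hinj : Function.Injective fun i => lab' (z i) := fun i j hij => by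
    rw [← hz i, ← hz j, h.1, ← h'.1]
    exact hij
  let g : Perm (Fin r) := Equiv.ofBijective _ (Finite.injective_iff_bijective.1 hinj)
  refine ⟨g, funext fun i => ?_, funext hcomp⟩
  have h1 : {x | lab' x = g i} = {x | lab x = i} := by
    ext x
    rw [Set.mem_ofPred_eq, Set.mem_ofPred_eq, ← hcomp x]
    exact g.injective.eq_iff
  have h2 := h'.2 (g i)
  rw [h1, h.2 i] at h2
  exact (Nat.succ_injective h2).symm

/-- Two numberings differ by a unique permutation of the indices, which must preserve the orders:
the numberings form a torsor under the stabilizer of `m`. -/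
theorem ncard_eq (h : IsLabelling κ m lab) :
    {lab | IsLabelling κ m lab}.ncard = {g : Perm (Fin r) | m ∘ g = m}.ncard := by
  have : {lab | IsLabelling κ m lab} = (fun g : Perm (Fin r) => g ∘ lab) '' {g | m ∘ g = m} := by
    ext l
    exact ⟨fun hl => h.exists_perm hl, by rintro ⟨g, hg, rfl⟩; exact h.perm_comp hg⟩
  rw [this, Set.ncard_image_of_injective]
  intro g g' hgg
  refine Equiv.ext fun i => ?_
  obtain ⟨x, rfl⟩ := h.surjective i
  exact congrFun hgg x

end IsLabelling

theorem ncard_perm_comp_eq {r : ℕ} {m : Fin r → ℕ} (hm : (∀ i, 1 ≤ m i) ∨ r = 1) :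
    {g : Perm (Fin r) | m ∘ g = m}.ncard =
      ∏ k ∈ Finset.Icc 1 (Finset.univ.sup m), (orderMultiplicity m k).factorial := by
  have h1 : {g : Perm (Fin r) | m ∘ g = m}.ncard =
      ∏ k ∈ Finset.univ.image m, (orderMultiplicity m k).factorial := by
    rw [← Nat.card_coe_set_eq, Set.coe_ofPred, Nat.card_eq_fintype_card,
      DomMulAct.stabilizer_card']
    refine Finset.prod_congr rfl fun k _ => ?_
    rw [Fintype.card_subtype]
    rfl
  -- Order 0 occurs at most once, for the marked torus, so its factorial is 1 and the product may
  -- start at 1.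
  have h0 : orderMultiplicity m 0 ≤ 1 := by
    rcases hm with hm | rfl
    · have : orderMultiplicity m 0 = 0 := by
        rw [orderMultiplicity, Finset.card_eq_zero, Finset.filter_eq_empty_iff]
        intro i _ hi
        have := hm i
        omega
      omega
    · exact (Finset.card_le_univ _).trans (by simp)
  have h0' : (orderMultiplicity m 0).factorial = 1 := by
    interval_cases orderMultiplicity m 0 <;> rfl
  have h2 : ∏ k ∈ Finset.univ.image m, (orderMultiplicity m k).factorial =
      ∏ k ∈ Finset.Icc 0 (Finset.univ.sup m), (orderMultiplicity m k).factorial := by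
    refine Finset.prod_subset (fun k hk => ?_) fun k _ hk => ?_
    · obtain ⟨i, -, rfl⟩ := Finset.mem_image.1 hk
      exact Finset.mem_Icc.2 ⟨Nat.zero_le _, Finset.le_sup (Finset.mem_univ i)⟩
    · have : orderMultiplicity m k = 0 := by
        rw [orderMultiplicity, Finset.card_eq_zero, Finset.filter_eq_empty_iff]
        intro i _ hi
        exact hk (Finset.mem_image.2 ⟨i, Finset.mem_univ i, hi⟩)
      rw [this, Nat.factorial_zero]
  rw [h1, h2]
  symm
  refine Finset.prod_subset (fun k hk => ?_) fun k hk hk' => ?_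
  · rw [Finset.mem_Icc] at hk ⊢
    omega
  · rw [Finset.mem_Icc] at hk hk'
    obtain rfl : k = 0 := by omega
    exact h0'

/-! ### Counting lengths, heights and twists -/

theorem ncard_positive_sum_eq {E : Type*} [Fintype E] [Nonempty E] {w : ℕ} (hw : 0 < w) :
    {ℓ : E → ℕ | (∀ y, 0 < ℓ y) ∧ ∑ y, ℓ y = w}.ncard =
      (w - 1).choose (Fintype.card E - 1) := by
  classical
  have hn : 0 < Fintype.card E := Fintype.card_pos
  have hle : ∀ ℓ : E → ℕ, (∀ y, 0 < ℓ y) → Fintype.card E ≤ ∑ y, ℓ y := fun ℓ h => by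
    have := Finset.sum_le_sum fun y (_ : y ∈ Finset.univ) => Nat.succ_le_of_lt (h y)
    simpa using this
  rcases lt_or_ge w (Fintype.card E) with hlt | hge
  · rw [Nat.choose_eq_zero_of_lt (by omega)]
    have : {ℓ : E → ℕ | (∀ y, 0 < ℓ y) ∧ ∑ y, ℓ y = w} = ∅ := by
      ext ℓ
      refine iff_of_false ?_ (Set.notMem_empty _)
      rintro ⟨h, hs⟩
      have := hle ℓ h
      omega
    rw [this, Set.ncard_empty]
  -- Stars and bars, after subtracting 1 from every length.
  · have h1 : {ℓ : E → ℕ | (∀ y, 0 < ℓ y) ∧ ∑ y, ℓ y = w} =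
        (fun (f : E →₀ ℕ) y => f y + 1) ''
          (Finset.univ.finsuppAntidiag (w - Fintype.card E) : Finset (E →₀ ℕ)) := by
      ext ℓ
      constructor
      · rintro ⟨h, hs⟩
        refine ⟨Finsupp.equivFunOnFinite.symm fun y => ℓ y - 1, ?_, ?_⟩
        · rw [Finset.mem_coe, Finset.mem_finsuppAntidiag]
          refine ⟨?_, Finset.subset_univ _⟩
          have h2 : ∑ y, (ℓ y - 1 + 1) = w := by
            rw [← hs]
            exact Finset.sum_congr rfl fun y _ => Nat.sub_add_cancel (h y)
          rw [Finset.sum_add_distrib] at h2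
          simp at h2 ⊢
          omega
        · funext y
          exact Nat.sub_add_cancel (h y)
      · rintro ⟨f, hf, rfl⟩
        rw [Finset.mem_coe, Finset.mem_finsuppAntidiag] at hf
        refine ⟨fun y => Nat.succ_pos _, ?_⟩
        rw [Finset.sum_add_distrib, hf.1]
        simp
        omega
    rw [h1, Set.ncard_image_of_injective, Set.ncard_coe_finset,
      Finset.card_finsuppAntidiag_nat_eq_choose, Finset.card_univ,
      Nat.choose_symm_of_eq_add (b := Fintype.card E - 1)]
    · congr 1
      omega
    · omega
    · intro f g hfg
      ext y
      exact Nat.succ_injective (congrFun hfg y)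

/-- The factor `w` counts the twists. It is absorbed by `w * C(w-1, n-1) = n * C(w, n)`, and the
hockey-stick identity does the sum. -/
theorem sum_mul_ncard_positive_sum_eq {E : Type*} [Fintype E] [Nonempty E] (M : ℕ) :
    ∑ w ∈ Finset.Icc 1 M, w * {ℓ : E → ℕ | (∀ y, 0 < ℓ y) ∧ ∑ y, ℓ y = w}.ncard =
      Fintype.card E * (M + 1).choose (Fintype.card E + 1) := by
  have hn : 0 < Fintype.card E := Fintype.card_pos
  rw [← Nat.sum_Icc_choose, Finset.mul_sum]
  have h1 : ∀ w ∈ Finset.Icc 1 M, w * {ℓ : E → ℕ | (∀ y, 0 < ℓ y) ∧ ∑ y, ℓ y = w}.ncard =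
      Fintype.card E * w.choose (Fintype.card E) := fun w hw => by
    have hw : 0 < w := (Finset.mem_Icc.1 hw).1
    rw [ncard_positive_sum_eq hw]
    have := Nat.add_one_mul_choose_eq (w - 1) (Fintype.card E - 1)
    rwa [Nat.sub_add_cancel hw, Nat.sub_add_cancel hn, mul_comm (w.choose _)] at this
  rw [Finset.sum_congr rfl h1]
  symm
  refine Finset.sum_subset (fun w hw => ?_) fun w hw hw' => ?_
  · rw [Finset.mem_Icc] at hw ⊢
    omega
  · rw [Finset.mem_Icc] at hw hw'
    rw [Nat.choose_eq_zero_of_lt (by omega), mul_zero]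

/-- The `n - 2` other lengths, each in `[1, w]`, determine the common value of the two equal ones
through the sum. -/
theorem ncard_positive_sum_eq_coincidence_le {E : Type*} [Fintype E] {y z : E} (hyz : y ≠ z)
    (w : ℕ) : {ℓ : E → ℕ | ((∀ x, 0 < ℓ x) ∧ ℓ y = ℓ z) ∧ ∑ x, ℓ x = w}.ncard ≤
      w ^ (Fintype.card E - 2) := by
  classical
  let E' := {x : E // x ∉ ({y, z} : Finset E)}
  have hcard : Fintype.card E' = Fintype.card E - 2 := by
    rw [Fintype.card_subtype_compl, Fintype.card_coe, Finset.card_pair hyz]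
  have hsum : ∀ ℓ : E → ℕ, ∑ x, ℓ x = ℓ y + ℓ z + ∑ x : E', ℓ x := fun ℓ => by
    rw [← Finset.sum_pair hyz, ← Finset.sum_add_sum_compl {y, z} ℓ]
    congr 1
    exact Finset.sum_subtype _ (by simp) _
  have h1 : (((Fintype.piFinset fun _ : E' => Finset.Icc 1 w) : Finset (E' → ℕ)) :
      Set (E' → ℕ)).ncard = w ^ (Fintype.card E - 2) := by
    rw [Set.ncard_coe_finset, Fintype.card_piFinset]
    simp [hcard]
  rw [← h1]
  refine Set.ncard_le_ncard_of_injOn (fun ℓ x => ℓ x.1) ?_ ?_ (Finset.finite_toSet _)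
  · rintro ℓ ⟨⟨h, -⟩, hs⟩
    rw [Finset.mem_coe, Fintype.mem_piFinset]
    intro x
    rw [Finset.mem_Icc, ← hs]
    exact ⟨h _, Finset.single_le_sum (f := ℓ) (fun _ _ => Nat.zero_le _) (Finset.mem_univ _)⟩
  · rintro ℓ ⟨⟨-, h⟩, hs⟩ ℓ' ⟨⟨-, h'⟩, hs'⟩ heq
    have h2 : ∑ x : E', ℓ x = ∑ x : E', ℓ' x := Finset.sum_congr rfl fun x _ => congrFun heq x
    rw [hsum] at hs hs'
    funext x
    by_cases hx : x ∈ ({y, z} : Finset E)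
    · rw [Finset.mem_insert, Finset.mem_singleton] at hx
      rcases hx with rfl | rfl <;> omega
    · exact congrFun heq ⟨x, hx⟩

theorem ncard_positive_sum_eq_not_injective_le {E : Type*} [Fintype E] (w : ℕ) :
    {ℓ : E → ℕ | ((∀ x, 0 < ℓ x) ∧ ¬ Function.Injective ℓ) ∧ ∑ x, ℓ x = w}.ncard ≤
      Fintype.card E ^ 2 * w ^ (Fintype.card E - 2) := by
  classical
  have hsub : {ℓ : E → ℕ | ((∀ x, 0 < ℓ x) ∧ ¬ Function.Injective ℓ) ∧ ∑ x, ℓ x = w} ⊆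
      ⋃ p ∈ (Finset.univ : Finset E).offDiag,
        {ℓ : E → ℕ | ((∀ x, 0 < ℓ x) ∧ ℓ p.1 = ℓ p.2) ∧ ∑ x, ℓ x = w} := by
    rintro ℓ ⟨⟨h, hinj⟩, hs⟩
    rw [Function.Injective] at hinj
    push Not at hinj
    obtain ⟨y, z, h1, h2⟩ := hinj
    exact Set.mem_biUnion (x := (y, z)) (by simpa using h2) ⟨⟨h, h1⟩, hs⟩
  have hfin : ∀ p : E × E,
      {ℓ : E → ℕ | ((∀ x, 0 < ℓ x) ∧ ℓ p.1 = ℓ p.2) ∧ ∑ x, ℓ x = w}.Finite := fun p => by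
    refine (Fintype.piFinset fun _ : E => Finset.Icc 0 w).finite_toSet.subset ?_
    rintro ℓ ⟨-, hs⟩
    rw [Finset.mem_coe, Fintype.mem_piFinset]
    intro x
    rw [Finset.mem_Icc, ← hs]
    exact ⟨Nat.zero_le _,
      Finset.single_le_sum (f := ℓ) (fun _ _ => Nat.zero_le _) (Finset.mem_univ _)⟩
  refine (Set.ncard_le_ncard hsub ((Finset.finite_toSet _).biUnion fun p _ => hfin p)).trans ?_
  refine (Finset.set_ncard_biUnion_le _ _).trans ?_
  refine (Finset.sum_le_card_nsmul _ _ (w ^ (Fintype.card E - 2)) fun p hp =>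
    ncard_positive_sum_eq_coincidence_le (Finset.mem_offDiag.1 hp).2.2 w).trans ?_
  rw [smul_eq_mul, Finset.offDiag_card, Finset.card_univ, sq]
  exact Nat.mul_le_mul_right _ (Nat.sub_le _ _)

open SquareTiledSurface in
-- Fibre over height and circumference: `h * w ≤ N` means `w ≤ N / h`, and each choice of lengths
-- admits `w` twists. The predicate `C` serves for all lengths and for non-injective ones.
theorem ncard_cylinderParameters {E : Type*} [Fintype E] (C : (E → ℕ) → Prop) (N : ℕ) :
    {x ∈ cylinderParameters E N | C x.1}.ncard =
      ∑ h ∈ Finset.Icc 1 N, ∑ w ∈ Finset.Icc 1 (N / h),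
        w * {ℓ : E → ℕ | ((∀ y, 0 < ℓ y) ∧ C ℓ) ∧ ∑ y, ℓ y = w}.ncard := by
  classical
  have hfin : {x ∈ cylinderParameters E N | C x.1}.Finite :=
    (cylinderParameters_finite E N).subset (Set.sep_subset _ _)
  rw [← Finset.sum_sigma' (Finset.Icc 1 N) (fun h => Finset.Icc 1 (N / h))
    (fun _ w => w * {ℓ : E → ℕ | ((∀ y, 0 < ℓ y) ∧ C ℓ) ∧ ∑ y, ℓ y = w}.ncard) |>.symm,
    Set.ncard_eq_toFinset_card _ hfin,
    Finset.card_eq_sum_card_fiberwise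
      (f := fun x : (E → ℕ) × ℕ × ℕ => (⟨x.2.1, ∑ y, x.1 y⟩ : Σ _ : ℕ, ℕ))
      (t := (Finset.Icc 1 N).sigma fun h => Finset.Icc 1 (N / h))]
  · refine Finset.sum_congr rfl ?_
    rintro ⟨h, w⟩ hhw
    rw [Finset.mem_sigma, Finset.mem_Icc, Finset.mem_Icc] at hhw
    dsimp only at hhw ⊢
    rw [← Set.ncard_coe_finset]
    have : ((hfin.toFinset.filter fun x => (⟨x.2.1, ∑ y, x.1 y⟩ : Σ _ : ℕ, ℕ) = ⟨h, w⟩ :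
        Finset ((E → ℕ) × ℕ × ℕ)) : Set ((E → ℕ) × ℕ × ℕ)) =
        (fun p : (E → ℕ) × ℕ => (p.1, h, p.2)) ''
          ({ℓ : E → ℕ | ((∀ y, 0 < ℓ y) ∧ C ℓ) ∧ ∑ y, ℓ y = w} ×ˢ (Finset.range w : Set ℕ)) := by
      ext ⟨ℓ, h', t⟩
      simp only [Finset.coe_filter, Set.Finite.mem_toFinset, Set.mem_ofPred_eq,
        cylinderParameters, Sigma.mk.injEq, heq_eq_eq, Set.mem_image, Set.mem_prod, Finset.coe_range,
        Set.mem_Iio, Prod.exists, Prod.mk.injEq]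
      constructor
      · rintro ⟨⟨⟨h1, h2, h3, h4⟩, h5⟩, rfl, rfl⟩
        exact ⟨ℓ, t, ⟨⟨⟨h1, h5⟩, rfl⟩, h3⟩, rfl, rfl, rfl⟩
      · rintro ⟨ℓ, t, ⟨⟨⟨h1, h5⟩, rfl⟩, h3⟩, rfl, rfl, rfl⟩
        exact ⟨⟨⟨h1, hhw.1.1, h3, by
          rw [mul_comm]; exact (Nat.le_div_iff_mul_le hhw.1.1).1 hhw.2.2⟩, h5⟩, rfl, rfl⟩
    rw [this, Set.ncard_image_of_injective, Set.ncard_prod, Set.ncard_coe_finset,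
      Finset.card_range, mul_comm]
    rintro ⟨ℓ, t⟩ ⟨ℓ', t'⟩ heq
    simpa using heq
  · rintro ⟨ℓ, h, t⟩ hx
    rw [Finset.mem_coe, Set.Finite.mem_toFinset] at hx
    obtain ⟨⟨h1, h2, h3, h4⟩, h5⟩ := hx
    dsimp only at h1 h2 h3 h4
    have hw : 0 < ∑ y, ℓ y := by omega
    simp only [Finset.coe_sigma, Set.mem_sigma_iff, Finset.coe_Icc, Set.mem_Icc]
    exact ⟨⟨h2, (Nat.le_mul_of_pos_right _ hw).trans h4⟩, hw,
      (Nat.le_div_iff_mul_le h2).2 (by rwa [mul_comm])⟩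

/-! ### Asymptotics of the counts -/

open Filter Topology

/-- If `G N ∼ c N ^ d` then `∑ h, G (N / h) ∼ c ζ(d) N ^ d`. -/
theorem tendsto_sum_div {d : ℕ} (hd : 2 ≤ d) {G : ℕ → ℝ} (hG0 : G 0 = 0) {c : ℝ}
    (hG : Tendsto (fun N : ℕ => G N / (N : ℝ) ^ d) atTop (𝓝 c)) :
    Tendsto (fun N : ℕ => (∑ h ∈ Finset.Icc 1 N, G (N / h)) / (N : ℝ) ^ d) atTop
      (𝓝 (c * ∑' h : ℕ, 1 / (h : ℝ) ^ d)) := by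
  obtain ⟨C, hC⟩ := hG.norm.bddAbove_range
  have hC : ∀ N : ℕ, ‖G N / (N : ℝ) ^ d‖ ≤ C := fun N => hC ⟨N, rfl⟩
  have hfactor : ∀ M N : ℕ, G M / (N : ℝ) ^ d =
      G M / (M : ℝ) ^ d * ((M : ℝ) / N) ^ d := fun M N => by
    rcases Nat.eq_zero_or_pos M with rfl | hM
    · simp [hG0]
    · have : (M : ℝ) ≠ 0 := by positivity
      rw [div_pow]
      field_simp
  have hle : ∀ N h : ℕ, ((N / h : ℕ) : ℝ) / N ≤ 1 / h := fun N h => by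
    rcases Nat.eq_zero_or_pos N with rfl | hN
    · simp
    · have hN' : (0 : ℝ) < N := by positivity
      rw [div_le_iff₀ hN', one_div_mul_eq_div]
      exact Nat.cast_div_le
  have hsumm : Summable fun h : ℕ => C * (1 / (h : ℝ) ^ d) :=
    (Real.summable_one_div_nat_pow.2 (by omega)).mul_left C
  -- The terms are dominated by `C / h ^ d`, with `C` a bound for `|G M| / M ^ d`, and each
  -- converges since `⌊N / h⌋ / N → 1 / h`. The term `h = 0` vanishes on both sides because division
  -- by zero gives 0.
  have key := tendsto_tsum_of_dominated_convergence (𝓕 := atTop)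
    (f := fun N h : ℕ => G (N / h) / (N : ℝ) ^ d) (g := fun h : ℕ => c * (1 / (h : ℝ) ^ d)) hsumm
    (fun h => ?_) (Eventually.of_forall fun N h => ?_)
  · rw [tsum_mul_left] at key
    refine key.congr fun N => ?_
    rw [tsum_eq_sum (s := Finset.Icc 1 N), Finset.sum_div]
    intro h hh
    rw [Finset.mem_Icc] at hh
    have : N / h = 0 := by
      rcases Nat.eq_zero_or_pos h with rfl | hpos
      · exact Nat.div_zero N
      · exact Nat.div_eq_of_lt (by omega)
    rw [this, hG0, zero_div]
  · rcases Nat.eq_zero_or_pos h with rfl | hpos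
    · have : (0 : ℝ) ^ d = 0 := zero_pow (by omega)
      simp [hG0, this]
    · refine Tendsto.congr (fun N => (hfactor (N / h) N).symm)
        ((hG.comp (Nat.tendsto_div_const_atTop hpos.ne')).mul ?_)
      rw [← one_div_pow]
      refine Tendsto.pow ?_ d
      have h1 := (tendsto_nat_floor_mul_div_atTop (R := ℝ) (a := 1 / h) (by positivity)).comp
        tendsto_natCast_atTop_atTop
      refine h1.congr fun N => ?_
      simp only [Function.comp, one_div_mul_eq_div, Nat.floor_div_natCast, Nat.floor_natCast]
  · rw [hfactor, norm_mul]
    refine mul_le_mul (hC _) ?_ (norm_nonneg _) ((norm_nonneg _).trans (hC 0))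
    rw [Real.norm_of_nonneg (by positivity), ← one_div_pow]
    exact pow_le_pow_left₀ (by positivity) (hle N h) d

theorem tendsto_choose_succ_div_pow (d : ℕ) :
    Tendsto (fun N : ℕ => ((N + 1).choose d : ℝ) / (N : ℝ) ^ d) atTop (𝓝 (1 / d.factorial)) := by
  have h1 : Tendsto (fun N : ℕ => (N.choose d : ℝ) / (N : ℝ) ^ d) atTop (𝓝 (1 / d.factorial)) := by
    have h := (Asymptotics.isEquivalent_iff_tendsto_one (by
      filter_upwards [eventually_gt_atTop 0] with N hN
      positivity)).1 (isEquivalent_choose d)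
    have h' := h.mul_const (1 / (d.factorial : ℝ))
    rw [one_mul] at h'
    refine h'.congr' ?_
    filter_upwards [eventually_gt_atTop 0] with N hN
    have : (d.factorial : ℝ) ≠ 0 := by positivity
    simp only [Pi.div_apply]
    field_simp
  have h2 : Tendsto (fun N : ℕ => (((N + 1 : ℕ) : ℝ) / N) ^ d) atTop (𝓝 1) := by
    have h := (tendsto_one_div_atTop_nhds_zero_nat (𝕜 := ℝ)).const_add 1
    rw [add_zero] at h
    have h' := h.pow d
    rw [one_pow] at h'
    refine h'.congr' ?_
    filter_upwards [eventually_gt_atTop 0] with N hN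
    push_cast
    field_simp
  have h3 := (h1.comp (tendsto_add_atTop_nat 1)).mul h2
  rw [mul_one] at h3
  refine h3.congr fun N => ?_
  simp only [Function.comp]
  have : ((N + 1 : ℕ) : ℝ) ≠ 0 := by positivity
  rw [div_pow]
  field_simp

open SquareTiledSurface in
theorem tendsto_ncard_cylinderParameters (E : Type*) [Fintype E] [Nonempty E] :
    Tendsto (fun N : ℕ => ((cylinderParameters E N).ncard : ℝ) / (N : ℝ) ^ (Fintype.card E + 1))
      atTop (𝓝 (Fintype.card E * (1 / (Fintype.card E + 1).factorial) *
        ∑' h : ℕ, 1 / (h : ℝ) ^ (Fintype.card E + 1))) := by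
  have hn : 0 < Fintype.card E := Fintype.card_pos
  have h := tendsto_sum_div (d := Fintype.card E + 1) (by omega)
    (G := fun M => (Fintype.card E : ℝ) * ((M + 1).choose (Fintype.card E + 1) : ℝ))
    (by rw [Nat.choose_eq_zero_of_lt (by omega)]; simp)
    (((tendsto_choose_succ_div_pow (Fintype.card E + 1)).const_mul (Fintype.card E : ℝ)).congr
      fun N => (mul_div_assoc _ _ _).symm)
  refine h.congr fun N => ?_
  have h1 := ncard_cylinderParameters (fun _ : E → ℕ => True) N
  simp only [and_true, sum_mul_ncard_positive_sum_eq] at h1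
  have h2 : {x | x ∈ cylinderParameters E N} = cylinderParameters E N := rfl
  rw [← h2, h1]
  push_cast
  rfl

open SquareTiledSurface in
theorem tendsto_ncard_cylinderParameters_not_injective (E : Type*) [Fintype E] [Nonempty E] :
    Tendsto (fun N : ℕ => ({x ∈ cylinderParameters E N | ¬ Function.Injective x.1}.ncard : ℝ) /
      (N : ℝ) ^ (Fintype.card E + 1)) atTop (𝓝 0) := by
  have hn : 0 < Fintype.card E := Fintype.card_pos
  set n := Fintype.card E
  let G : ℕ → ℕ := fun M => ∑ w ∈ Finset.Icc 1 M,
    w * {ℓ : E → ℕ | ((∀ y, 0 < ℓ y) ∧ ¬ Function.Injective ℓ) ∧ ∑ y, ℓ y = w}.ncard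
  have hG : ∀ M, G M ≤ n ^ 2 * M ^ n := fun M => by
    -- For `n = 1` the truncated exponent `n - 2` would spoil the bound, but a single length has no
    -- coincidences.
    rcases Nat.lt_or_ge n 2 with hn2 | hn2
    · have : Subsingleton E := Fintype.card_le_one_iff_subsingleton.1 (by omega)
      have h0 : G M = 0 := Finset.sum_eq_zero fun w _ => by
        have : {ℓ : E → ℕ | ((∀ y, 0 < ℓ y) ∧ ¬ Function.Injective ℓ) ∧ ∑ y, ℓ y = w} = ∅ := by
          ext ℓ
          exact iff_of_false (fun h => h.1.2 (Function.injective_of_subsingleton ℓ))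
            (Set.notMem_empty _)
        rw [this, Set.ncard_empty, mul_zero]
      omega
    · have h1 : ∀ w ∈ Finset.Icc 1 M,
          w * {ℓ : E → ℕ | ((∀ y, 0 < ℓ y) ∧ ¬ Function.Injective ℓ) ∧ ∑ y, ℓ y = w}.ncard ≤
          n ^ 2 * M ^ (n - 1) := fun w hw => by
        have hw : w ≤ M := (Finset.mem_Icc.1 hw).2
        calc _ ≤ M * (n ^ 2 * M ^ (n - 2)) := Nat.mul_le_mul hw
              ((ncard_positive_sum_eq_not_injective_le w).trans
                (Nat.mul_le_mul_left _ (Nat.pow_le_pow_left hw _)))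
          _ = n ^ 2 * M ^ (n - 1) := by
            rw [show n - 1 = n - 2 + 1 by omega, pow_succ]
            ring
      refine (Finset.sum_le_card_nsmul _ _ _ h1).trans (le_of_eq ?_)
      obtain ⟨k, hk⟩ := Nat.exists_eq_add_of_le' hn
      rw [Nat.card_Icc, smul_eq_mul, Nat.add_sub_cancel, hk, Nat.add_sub_cancel, pow_succ]
      ring
  -- A coincidence of lengths costs one power of the area bound, so the case of limit constant 0 of
  -- `tendsto_sum_div` applies.
  have hlim : Tendsto (fun N : ℕ => (G N : ℝ) / (N : ℝ) ^ (n + 1)) atTop (𝓝 0) := by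
    have h1 : Tendsto (fun N : ℕ => (n : ℝ) ^ 2 * (1 / (N : ℝ))) atTop (𝓝 0) := by
      simpa using (tendsto_one_div_atTop_nhds_zero_nat (𝕜 := ℝ)).const_mul ((n : ℝ) ^ 2)
    refine squeeze_zero' (Eventually.of_forall fun N => by positivity) ?_ h1
    filter_upwards [eventually_gt_atTop 0] with N hN
    have hN' : (0 : ℝ) < N := by positivity
    rw [div_le_iff₀ (by positivity)]
    have h2 : (G N : ℝ) ≤ (n : ℝ) ^ 2 * (N : ℝ) ^ n := by exact_mod_cast hG N
    refine h2.trans (le_of_eq ?_)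
    rw [pow_succ (N : ℝ) n]
    field_simp
  have h := tendsto_sum_div (d := n + 1) (by omega) (G := fun M => (G M : ℝ)) (by simp [G]) hlim
  rw [zero_mul] at h
  refine h.congr fun N => ?_
  rw [ncard_cylinderParameters (fun ℓ : E → ℕ => ¬ Function.Injective ℓ) N]
  push_cast [G]
  rfl

theorem tendsto_comp_floor_div_pow {u : ℕ → ℝ} {d : ℕ} {c : ℝ}
    (hu : Tendsto (fun N : ℕ => u N / (N : ℝ) ^ d) atTop (𝓝 c)) :
    Tendsto (fun a : ℝ => u ⌊a⌋₊ / a ^ d) atTop (𝓝 c) := by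
  have h := (hu.comp (tendsto_nat_floor_atTop (α := ℝ))).mul
    ((tendsto_nat_floor_div_atTop (R := ℝ)).pow d)
  rw [one_pow, mul_one] at h
  refine h.congr' ?_
  filter_upwards [eventually_ge_atTop 1] with a ha
  have h1 : 0 < ⌊a⌋₊ := Nat.floor_pos.2 ha
  have h2 : (⌊a⌋₊ : ℝ) ≠ 0 := by positivity
  have h3 : a ≠ 0 := by positivity
  simp only [Function.comp]
  rw [div_pow]
  field_simp

theorem proposition2p1 {H : Type*} [Finite H] (D : SeparatrixDiagram H)
    (hor : D.IsOrientable) (hone : D.IsOneCylinder)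
    (g r : ℕ) (m : Fin r → ℕ) (hm : (∀ i, 1 ≤ m i) ∨ r = 1)
    (hg : ∑ i, (m i : ℤ) = 2 * (g : ℤ) - 2) (hD : D.InStratum m)
    (d : ℕ) (hd : (d : ℤ) = 2 * (g : ℤ) + (r : ℤ) - 1) :
    ∃ c : ℝ, HasContribution D m d c ∧
      (c : ℂ) = 2 / (Nat.card D.symmetryGroup : ℂ) *
        (((∏ k ∈ Finset.Icc 1 (Finset.univ.sup m), (orderMultiplicity m k).factorial : ℕ) : ℂ) /
          ((d - 2).factorial : ℂ)) * riemannZeta (d : ℂ) := by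
  have := Fintype.ofFinite D.Edge
  have := D.nonempty_edge hone
  obtain ⟨lab, hlab⟩ := hD.exists_isLabelling hor
  have hn : 0 < Fintype.card D.Edge := Fintype.card_pos
  -- Each vertex has `m i + 1` outgoing edges, so `n = (2g - 2) + r`.
  have hcard : d = Fintype.card D.Edge + 1 := by
    have h1 : (Fintype.card D.Edge : ℤ) = ∑ i, (m i : ℤ) + r := by
      rw [hlab.card_eq, Finset.sum_add_distrib]
      push_cast
      simp
    omega
  have hΛ := hlab.ncard_eq.trans (ncard_perm_comp_eq hm)
  set P := ∏ k ∈ Finset.Icc 1 (Finset.univ.sup m), (orderMultiplicity m k).factorial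
  set n := Fintype.card D.Edge
  set Γ := Nat.card D.symmetryGroup
  have hΓ : (0 : ℝ) < Γ := Nat.cast_pos.2 Nat.card_pos
  have hA := tendsto_comp_floor_div_pow
    (u := fun N => ((SquareTiledSurface.cylinderParameters D.Edge N).ncard : ℝ))
    (tendsto_ncard_cylinderParameters D.Edge)
  have hB := tendsto_comp_floor_div_pow
    (u := fun N => ({x ∈ SquareTiledSurface.cylinderParameters D.Edge N |
      ¬ Function.Injective x.1}.ncard : ℝ))
    (tendsto_ncard_cylinderParameters_not_injective D.Edge)
  rw [← hcard] at hA hB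
  set Z := ∑' h : ℕ, 1 / (h : ℝ) ^ d
  have hlow := hA.mul_const (P : ℝ)
  have hupp := hlow.add ((hB.mul_const (P : ℝ)).const_mul (Γ : ℝ))
  rw [zero_mul, mul_zero, add_zero] at hupp
  -- Squeeze: the two bounds differ by the parameters with coinciding lengths, which are negligible
  -- against `a ^ d`.
  have hcount : Tendsto (fun a : ℝ => Γ * (countSquareTiled D m a : ℝ) / a ^ d) atTop
      (𝓝 (n * (1 / d.factorial) * Z * P)) := by
    refine tendsto_of_tendsto_of_tendsto_of_le_of_le' hlow hupp ?_ ?_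
    · filter_upwards [eventually_gt_atTop 0] with a ha
      have h := (countSquareTiled_bounds hor hone m a ha.le).1
      rw [hΛ] at h
      rw [div_mul_eq_mul_div]
      refine div_le_div_of_nonneg_right ?_ (by positivity)
      exact_mod_cast h
    · filter_upwards [eventually_gt_atTop 0] with a ha
      have h := (countSquareTiled_bounds hor hone m a ha.le).2
      rw [hΛ] at h
      rw [div_mul_eq_mul_div, div_mul_eq_mul_div, mul_div_assoc', ← add_div]
      refine div_le_div_of_nonneg_right ?_ (by positivity)
      exact_mod_cast h
  -- With `n = d - 1`, the factor `n` from the twists and the normalization `2d` cancel `d!` down to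
  -- `(d - 2)!`.
  have hfact : (d.factorial : ℝ) = d * (n * (d - 2).factorial) := by
    obtain ⟨k, hk⟩ := Nat.exists_eq_add_of_le' hn
    rw [hcard, hk, show k + 1 + 1 - 2 = k by omega, Nat.factorial_succ, Nat.factorial_succ]
    push_cast
    ring
  have hdpos : (d : ℝ) ≠ 0 := by rw [hcard]; positivity
  have hnpos : (n : ℝ) ≠ 0 := by positivity
  have hZ : (Z : ℂ) = riemannZeta d := by
    rw [zeta_nat_eq_tsum_of_gt_one (by omega), Complex.ofReal_tsum]
    push_cast
    rfl
  refine ⟨2 / Γ * (P / (d - 2).factorial) * Z, ?_, ?_⟩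
  · have h := hcount.const_mul (2 * (d : ℝ) / Γ)
    have hlimit : 2 * (d : ℝ) / Γ * (n * (1 / d.factorial) * Z * P) =
        2 / Γ * (P / (d - 2).factorial) * Z := by
      rw [hfact]
      have : ((d - 2).factorial : ℝ) ≠ 0 := by positivity
      field_simp
    rw [hlimit] at h
    refine h.congr fun a => ?_
    field_simp
  · rw [← hZ]
    push_cast
    rfl
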